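/- Consider the wave equation $\mathcal W$: $w_{\xi\eta}=0$ for $w=w(\xi,\eta)$, and let $w_{kl}$ ($k,l\ge 0$) denote the jet coordinates corresponding to $\partial^{k+l}w/\partial\xi^k\partial\eta^l$. Write $F=F[w|\eta]$ if $F$ is a smooth function of $\eta$ and finitely many $w_{0l}$, $l\ge1$, and $G=G[w|\xi]$ if $G$ is a smooth function of $\xi$ and finitely many $w_{k0}$, $k\ge1$. Put $\mathscr D_\eta=\partial_\eta+\sum_l w_{0,l+1}\partial_{w_{0l}}$ and $\mathscr D_\xi=\partial_\xi+\sum_k w_{k+1,0}\partial_{w_{k0}}$. A differential function is a smooth function of $\xi$, $\eta$ and finitely many $w_{kl}$. A pair of differential functions $(F,G)$ is a conserved current of $\mathcal W$ if $\mathrm D_\xi F+\mathrm D_\eta G$ vanishes on the solution set of $\mathcal W$ (that is, where $w_{kl}=0$ for all $k,l\ge1$), where $\mathrm D_\xi,\mathrm D_\eta$ are the total derivatives. It is a trivial conserved current if it is the sum of a pair of differential functions vanishing on the solution set of $\mathcal W$ and a pair of differential functions $(P,Q)$ with $\mathrm D_\xi P+\mathrm D_\eta Q=0$ identically. Let $A$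 be an open set in the space of $(\eta,w_{01},\dots,w_{0r_1})$ and $B$ an open set in the space of $(\xi,w_{10},\dots,w_{r_20})$, and let $\Omega$ be the set of jets with $(\eta,w_{01},\dots,w_{0r_1})\in A$ and $(\xi,w_{10},\dots,w_{r_20})\in B$, on which all functions are considered. Let $V$ be the space of the pairs $(F[w|\eta],G[w|\xi])$ on $\Omega$, and let $V_0$ be the space of the trivial conserved currents on $\Omega$ that belong to $V$. Then $V_0$ consists exactly of the pairs $(F,G)\in V$ that can be locally (in a neighbourhood of each point of $\Omega$) represented in the form $$F=\mathscr D_\eta\tilde F+C\,w_{01},\qquad G=\mathscr D_\xi\tilde G-C\,w_{10}$$ for some $\tilde F=\tilde F[w|\eta]$, some $\tilde G=\tilde G[w|\xi]$ and some constant $C$. This holds both when $C$ is required to be the same at all points of $\Omega$ and when it is allowed to depend on the point. -/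

import Mathlib

namespace WaveCC

open scoped ContDiff

noncomputable section

/-- A point of the infinite jet space of functions `w = w(ξ, η)`: the triple of `ξ`, `η` and the
family of jet coordinates `w_{kl}`, where `w_{kl}` stands for `∂^{k+l} w / ∂ξ^k ∂η^l`.
It carries the product topology. -/
abbrev Jet : Type := ℝ × ℝ × (ℕ × ℕ → ℝ)

/-- The coordinate `ξ`. -/
def xi (j : Jet) : ℝ := j.1

/-- The coordinate `η`. -/
def eta (j : Jet) : ℝ := j.2.1

/-- The coordinate `w_{kl}`. -/
def w (k l : ℕ) (j : Jet) : ℝ := j.2.2 (k, l)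

/-! ### Partial derivatives in the jet coordinates and total derivatives -/

/-- `∂f/∂ξ`, all other jet coordinates being fixed. -/
def pXi (f : Jet → ℝ) (j : Jet) : ℝ := deriv (fun t : ℝ => f (t, j.2.1, j.2.2)) (xi j)

/-- `∂f/∂η`, all other jet coordinates being fixed. -/
def pEta (f : Jet → ℝ) (j : Jet) : ℝ := deriv (fun t : ℝ => f (j.1, t, j.2.2)) (eta j)

/-- `∂f/∂w_{kl}`, all other jet coordinates being fixed. -/
def pW (k l : ℕ) (f : Jet → ℝ) (j : Jet) : ℝ :=
  deriv (fun t : ℝ => f (j.1, j.2.1, Function.update j.2.2 (k, l) t)) (w k l j)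

/-- The total derivative `D_ξ = ∂_ξ + ∑_{k,l ≥ 0} w_{k+1,l} ∂_{w_{kl}}`.
The sum is finite for functions of finitely many jet coordinates. -/
def DXi (f : Jet → ℝ) (j : Jet) : ℝ :=
  pXi f j + ∑ᶠ p : ℕ × ℕ, w (p.1 + 1) p.2 j * pW p.1 p.2 f j

/-- The total derivative `D_η = ∂_η + ∑_{k,l ≥ 0} w_{k,l+1} ∂_{w_{kl}}`. -/
def DEta (f : Jet → ℝ) (j : Jet) : ℝ :=
  pEta f j + ∑ᶠ p : ℕ × ℕ, w p.1 (p.2 + 1) j * pW p.1 p.2 f j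

/-- The evaluation `𝒟_ξ = ∂_ξ + ∑_k w_{k+1,0} ∂_{w_{k0}}` of `D_ξ` on solutions of `w_{ξη} = 0`
(for functions of `ξ` and of `w_{k0}`, `k ≥ 1`, the summand with `k = 0` vanishes). -/
def sDXi (f : Jet → ℝ) (j : Jet) : ℝ :=
  pXi f j + ∑ᶠ k : ℕ, w (k + 1) 0 j * pW k 0 f j

/-- The evaluation `𝒟_η = ∂_η + ∑_l w_{0,l+1} ∂_{w_{0l}}` of `D_η` on solutions of `w_{ξη} = 0`
(for functions of `η` and of `w_{0l}`, `l ≥ 1`, the summand with `l = 0` vanishes). -/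
def sDEta (f : Jet → ℝ) (j : Jet) : ℝ :=
  pEta f j + ∑ᶠ l : ℕ, w 0 (l + 1) j * pW 0 l f j

/-! ### Differential functions -/

/-- The coordinates `ξ`, `η` and `w_{kl}` with `k, l ≤ n`. -/
def jetTrunc (n : ℕ) (j : Jet) : ℝ × ℝ × (Fin (n + 1) × Fin (n + 1) → ℝ) :=
  (xi j, eta j, fun p => w p.1 p.2 j)

/-- The coordinates `η, w_{01}, …, w_{0r}`. -/
def etaTrunc (r : ℕ) (j : Jet) : ℝ × (Fin r → ℝ) := (eta j, fun l => w 0 (l + 1) j)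

/-- The coordinates `ξ, w_{10}, …, w_{r0}`. -/
def xiTrunc (r : ℕ) (j : Jet) : ℝ × (Fin r → ℝ) := (xi j, fun k => w (k + 1) 0 j)

/-- On `Ω`, `f` is a differential function: a smooth function of `ξ`, `η` and finitely many
`w_{kl}`. (The values of `f` outside of `Ω` are irrelevant.) -/
def IsDiffFun (Ω : Set Jet) (f : Jet → ℝ) : Prop :=
  ∃ (n : ℕ) (φ : ℝ × ℝ × (Fin (n + 1) × Fin (n + 1) → ℝ) → ℝ),
    ContDiffOn ℝ ∞ φ (jetTrunc n '' Ω) ∧ ∀ j ∈ Ω, f j = φ (jetTrunc n j)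

/-- On `Ω`, `f = f[w|η]`: a smooth function of `η` and finitely many `w_{0l}`, `l ≥ 1`. -/
def IsEtaFun (Ω : Set Jet) (f : Jet → ℝ) : Prop :=
  ∃ (r : ℕ) (φ : ℝ × (Fin r → ℝ) → ℝ),
    ContDiffOn ℝ ∞ φ (etaTrunc r '' Ω) ∧ ∀ j ∈ Ω, f j = φ (etaTrunc r j)

/-- On `Ω`, `f = f[w|ξ]`: a smooth function of `ξ` and finitely many `w_{k0}`, `k ≥ 1`. -/
def IsXiFun (Ω : Set Jet) (f : Jet → ℝ) : Prop :=
  ∃ (r : ℕ) (φ : ℝ × (Fin r → ℝ) → ℝ),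
    ContDiffOn ℝ ∞ φ (xiTrunc r '' Ω) ∧ ∀ j ∈ Ω, f j = φ (xiTrunc r j)

/-- The set of jets on which a pair `(F[w|η], G[w|ξ])` is defined, when `F` has the domain `A` in
the space of `(η, w_{01}, …, w_{0r₁})` and `G` has the domain `B` in the space of
`(ξ, w_{10}, …, w_{r₂0})`. -/
def jetDomain {r₁ r₂ : ℕ} (A : Set (ℝ × (Fin r₁ → ℝ))) (B : Set (ℝ × (Fin r₂ → ℝ))) : Set Jet :=
  {j | etaTrunc r₁ j ∈ A ∧ xiTrunc r₂ j ∈ B}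

/-! ### Conserved currents of `w_{ξη} = 0` -/

/-- The equation `w_{11} = 0` together with all its differential consequences `w_{kl} = 0`,
`k, l ≥ 1`, as a subset of the jet space. -/
def solutionManifold : Set Jet := {j | ∀ k l : ℕ, w (k + 1) (l + 1) j = 0}

/-- The total divergence `D_ξ F + D_η G`. -/
def totalDiv (P : (Jet → ℝ) × (Jet → ℝ)) (j : Jet) : ℝ := DXi P.1 j + DEta P.2 j

/-- A conserved current on `Ω`: a pair of differential functions whose total divergence vanishes
on solutions. -/
structure IsConservedCurrent (Ω : Set Jet) (P : (Jet → ℝ) × (Jet → ℝ)) : Prop where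
  fst : IsDiffFun Ω P.1
  snd : IsDiffFun Ω P.2
  div_eq_zero : ∀ j ∈ Ω ∩ solutionManifold, totalDiv P j = 0

/-- Triviality of the first kind: both components vanish on solutions. -/
structure VanishesOnSolutions (Ω : Set Jet) (P : (Jet → ℝ) × (Jet → ℝ)) : Prop where
  fst : IsDiffFun Ω P.1
  snd : IsDiffFun Ω P.2
  fst_eq_zero : ∀ j ∈ Ω ∩ solutionManifold, P.1 j = 0
  snd_eq_zero : ∀ j ∈ Ω ∩ solutionManifold, P.2 j = 0

/-- Triviality of the second kind (null divergence): the total divergence vanishes identically. -/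
structure IsNullDivergence (Ω : Set Jet) (P : (Jet → ℝ) × (Jet → ℝ)) : Prop where
  fst : IsDiffFun Ω P.1
  snd : IsDiffFun Ω P.2
  div_eq_zero : ∀ j ∈ Ω, totalDiv P j = 0

/-- A trivial conserved current: the sum of a current vanishing on solutions and a
null divergence. -/
def IsTrivialConservedCurrent (Ω : Set Jet) (P : (Jet → ℝ) × (Jet → ℝ)) : Prop :=
  IsConservedCurrent Ω P ∧
    ∃ P' P'' : (Jet → ℝ) × (Jet → ℝ), VanishesOnSolutions Ω P' ∧ IsNullDivergence Ω P'' ∧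
      ∀ j ∈ Ω, P.1 j = P'.1 j + P''.1 j ∧ P.2 j = P'.2 j + P''.2 j

/-- The space `V` of the pairs `(F[w|η], G[w|ξ])` on `Ω`. -/
def V (Ω : Set Jet) : Set ((Jet → ℝ) × (Jet → ℝ)) := {P | IsEtaFun Ω P.1 ∧ IsXiFun Ω P.2}

/-- The space `V₀` of the trivial conserved currents that belong to `V`. -/
def V₀ (Ω : Set Jet) : Set ((Jet → ℝ) × (Jet → ℝ)) := {P ∈ V Ω | IsTrivialConservedCurrent Ω P}

/-- In a neighbourhood of `j₀` in `Ω`, the pair has the form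
`(𝒟_η F̃ + C w_{01}, 𝒟_ξ G̃ - C w_{10})` with `F̃ = F̃[w|η]` and `G̃ = G̃[w|ξ]`. -/
def HasLocalForm (Ω : Set Jet) (C : ℝ) (P : (Jet → ℝ) × (Jet → ℝ)) (j₀ : Jet) : Prop :=
  ∃ Ω' : Set Jet, IsOpen Ω' ∧ j₀ ∈ Ω' ∧ Ω' ⊆ Ω ∧
    ∃ F' G' : Jet → ℝ, IsEtaFun Ω' F' ∧ IsXiFun Ω' G' ∧
      ∀ j ∈ Ω', P.1 j = sDEta F' j + C * w 0 1 j ∧ P.2 j = sDXi G' j - C * w 1 0 j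

end

end WaveCC

/-! Let E_η = ∑ (-D_η)^k ∂/∂w_{0,k+1} and E_ξ = ∑ (-D_ξ)^k ∂/∂w_{k+1,0} be the Euler operators in
which w_{01} and w_{10} play the role of the unknown function. Triviality and the local form are
both compared with the single condition E_η F + E_ξ G = 0.

From triviality to the local form: applying ∑ (-D_η)^l (-D_ξ)^k ∂/∂w_{k+1,l+1} to D_ξ P + D_η Q = 0
telescopes to E_η P + E_ξ Q = 0 (`higherEuler_add_higherEuler_eq_zero`). The operators preserve
vanishing on solutions, because every vector field in them is tangent to the solution manifold. So
E_η F + E_ξ G vanishes on solutions. The first summand lives on the η-axis, the second on the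
ξ-axis, and Ω is a product; hence they are constants C and -C on the whole of Ω, with no
connectedness needed (`exists_const_of_add_mem_solIdeal`). A function on one axis whose Euler
operator is constant is locally D g + C w_1: the higher Euler operators are the would-be partial
derivatives of g, the Helmholtz conditions make the resulting 1-form closed, and the Poincaré lemma
integrates it (`Axis.exists_local_primitive`).

From the local form to triviality: Euler operators kill total derivatives, so near each point E_η F
= C and E_ξ G = -C; the sum is zero even if C varies with the point. Integration by parts
(`Axis.lie_add_lie_field`) writes D_ξ F + D_η G as w_{11}(E_η F + E_ξ G) minus the divergence of a
pair whose terms all carry a factor w_{1l} or w_{k1}. Adding that pair gives a null divergence, and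
the pair itself vanishes on solutions.

The cycle "trivial ⇒ one C ⇒ a C at each point ⇒ trivial" gives both versions of the theorem. -/

open scoped ContDiff Topology

/-! ### Smooth functions of finitely many coordinates on a topological vector space -/

section Cylinder

variable {J : Type*} [AddCommGroup J] [Module ℝ J] [TopologicalSpace J]
  {E : Type*} [NormedAddCommGroup E] [NormedSpace ℝ E]
  {E' : Type*} [NormedAddCommGroup E'] [NormedSpace ℝ E']
  {F : Type*} [NormedAddCommGroup F] [NormedSpace ℝ F]

/-- On `Ω`, the function `f` factors smoothly through the linear map `T`. -/
def IsCylinder (T : J →L[ℝ] E) (Ω : Set J) (f : J → F) : Prop :=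
  ∃ φ : E → F, ContDiffOn ℝ ∞ φ (T '' Ω) ∧ ∀ j ∈ Ω, f j = φ (T j)

theorem exists_continuousLinearMap_comp_eq [FiniteDimensional ℝ E'] {T' : J →L[ℝ] E'}
    (hT' : Function.Surjective T') (S : J →ₗ[ℝ] E) (h : ∀ j, T' j = 0 → S j = 0) :
    ∃ p : E' →L[ℝ] E, ∀ j, S j = p (T' j) := by
  obtain ⟨s, hs⟩ := (T' : J →ₗ[ℝ] E').exists_rightInverse_of_surjective
    (LinearMap.range_eq_top.2 hT')
  refine ⟨LinearMap.toContinuousLinearMap (S ∘ₗ s), fun j => ?_⟩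
  have hs' : ∀ y, T' (s y) = y := fun y => by simpa using LinearMap.congr_fun hs y
  have := h (j - s (T' j)) (by simp [hs'])
  simpa [sub_eq_zero] using this

namespace IsCylinder

variable {T : J →L[ℝ] E} {Ω : Set J} {f g : J → F}

theorem congr (hf : IsCylinder T Ω f) (h : ∀ j ∈ Ω, g j = f j) : IsCylinder T Ω g := by
  obtain ⟨φ, hφ, hfφ⟩ := hf
  exact ⟨φ, hφ, fun j hj => (h j hj).trans (hfφ j hj)⟩

theorem mono_set {Ω' : Set J} (hf : IsCylinder T Ω f) (h : Ω' ⊆ Ω) : IsCylinder T Ω' f := by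
  obtain ⟨φ, hφ, hfφ⟩ := hf
  exact ⟨φ, hφ.mono (Set.image_mono h), fun j hj => hfφ j (h hj)⟩

/-- A smaller kernel means that `T'` retains at least the coordinates of `T`, so that `T` is a
linear function of `T'`. -/
theorem mono [FiniteDimensional ℝ E'] {T' : J →L[ℝ] E'}
    (hT' : Function.Surjective T') (h : ∀ j, T' j = 0 → T j = 0)
    (hf : IsCylinder T Ω f) : IsCylinder T' Ω f := by
  obtain ⟨φ, hφ, hfφ⟩ := hf
  obtain ⟨p, hp⟩ := exists_continuousLinearMap_comp_eq hT' (T : J →ₗ[ℝ] E) h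
  replace hp : ∀ j, T j = p (T' j) := hp
  refine ⟨φ ∘ p, hφ.comp p.contDiff.contDiffOn ?_, fun j hj => by simp [hfφ j hj, hp]⟩
  rintro _ ⟨j, hj, rfl⟩
  exact ⟨j, hj, hp j⟩

theorem const (c : F) : IsCylinder T Ω (fun _ => c) := ⟨fun _ => c, contDiffOn_const, fun _ _ => rfl⟩

theorem linear (S : E →L[ℝ] F) (h : ∀ j, f j = S (T j)) : IsCylinder T Ω f :=
  ⟨S, S.contDiff.contDiffOn, fun j _ => h j⟩

theorem add (hf : IsCylinder T Ω f) (hg : IsCylinder T Ω g) :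
    IsCylinder T Ω (fun j => f j + g j) := by
  obtain ⟨φ, hφ, hfφ⟩ := hf
  obtain ⟨ψ, hψ, hgψ⟩ := hg
  exact ⟨fun y => φ y + ψ y, hφ.add hψ, fun j hj => by simp [hfφ j hj, hgψ j hj]⟩

theorem smul {a : J → ℝ} (ha : IsCylinder T Ω a) (hg : IsCylinder T Ω g) :
    IsCylinder T Ω (fun j => a j • g j) := by
  obtain ⟨φ, hφ, hfφ⟩ := ha
  obtain ⟨ψ, hψ, hgψ⟩ := hg
  exact ⟨fun y => φ y • ψ y, hφ.smul hψ, fun j hj => by simp [hfφ j hj, hgψ j hj]⟩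

theorem mul {a b : J → ℝ} (ha : IsCylinder T Ω a) (hb : IsCylinder T Ω b) :
    IsCylinder T Ω (fun j => a j * b j) := ha.smul hb

theorem neg (hf : IsCylinder T Ω f) : IsCylinder T Ω (fun j => -f j) := by
  obtain ⟨φ, hφ, hfφ⟩ := hf
  exact ⟨fun y => -φ y, hφ.neg, fun j hj => by simp [hfφ j hj]⟩

theorem sum {ι : Type*} (s : Finset ι) {f : ι → J → F} (hf : ∀ i ∈ s, IsCylinder T Ω (f i)) :
    IsCylinder T Ω (fun j => ∑ i ∈ s, f i j) := by
  classical
  induction s using Finset.induction_on with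
  | empty => simpa using const 0
  | insert i s hi ih =>
    simp only [Finset.sum_insert hi]
    exact (hf i (by simp)).add (ih fun k hk => hf k (by simp [hk]))

end IsCylinder

/-! ### Directional derivatives of cylindrical functions -/

variable [IsTopologicalAddGroup J] [ContinuousSMul ℝ J]

/-- `J` need not be normed; this transfers every question of differentiability to an open subset of
`E`. -/
theorem isOpen_image_of_surjective [FiniteDimensional ℝ E] {T : J →L[ℝ] E}
    (hT : Function.Surjective T) {Ω : Set J} (hΩ : IsOpen Ω) : IsOpen (T '' Ω) :=
  (T : J →ₗ[ℝ] E).isOpenMap_of_finiteDimensional hT _ hΩ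

theorem eventually_add_smul_mem {Ω : Set J} (hΩ : IsOpen Ω) {j : J} (hj : j ∈ Ω) (v : J) :
    ∀ᶠ t : ℝ in 𝓝 0, j + t • v ∈ Ω :=
  (Continuous.tendsto' (by fun_prop) 0 j (by simp)).eventually (hΩ.mem_nhds hj)

theorem hasLineDerivAt_of_eq_comp {T : J →L[ℝ] E} {Ω : Set J}
    (hΩ : IsOpen Ω) {f : J → F} {φ : E → F} (hf : ∀ j ∈ Ω, f j = φ (T j)) {j : J} (hj : j ∈ Ω)
    (hφ : DifferentiableAt ℝ φ (T j)) (v : J) :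
    HasLineDerivAt ℝ f (fderiv ℝ φ (T j) (T v)) j v := by
  have h := hφ.hasFDerivAt.hasLineDerivAt (T v)
  refine HasDerivAt.congr_of_eventuallyEq h ?_
  filter_upwards [eventually_add_smul_mem hΩ hj v] with t ht
  simp [hf _ ht]

theorem lineDeriv_congr_of_isOpen {Ω : Set J} (hΩ : IsOpen Ω) {f g : J → F}
    (h : ∀ j ∈ Ω, f j = g j) {j : J} (hj : j ∈ Ω) (v : J) :
    lineDeriv ℝ f j v = lineDeriv ℝ g j v := by
  refine Filter.EventuallyEq.deriv_eq ?_
  filter_upwards [eventually_add_smul_mem hΩ hj v] with t ht using h _ ht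

variable [FiniteDimensional ℝ E]

theorem ContDiffOn.differentiableAt_image {T : J →L[ℝ] E} (hT : Function.Surjective T)
    {Ω : Set J} (hΩ : IsOpen Ω) {φ : E → F} (hφ : ContDiffOn ℝ ∞ φ (T '' Ω)) {j : J}
    (hj : j ∈ Ω) : DifferentiableAt ℝ φ (T j) :=
  (hφ.contDiffAt ((isOpen_image_of_surjective hT hΩ).mem_nhds ⟨j, hj, rfl⟩)).differentiableAt
    (by simp)

namespace IsCylinder

variable {T : J →L[ℝ] E} {Ω : Set J} {f g : J → F}

theorem exists_hasLineDerivAt (hT : Function.Surjective T) (hΩ : IsOpen Ω)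
    (hf : IsCylinder T Ω f) {j : J} (hj : j ∈ Ω) :
    ∃ L : E →L[ℝ] F, ∀ v, HasLineDerivAt ℝ f (L (T v)) j v := by
  obtain ⟨φ, hφ, hfφ⟩ := hf
  exact ⟨fderiv ℝ φ (T j), fun v =>
    hasLineDerivAt_of_eq_comp hΩ hfφ hj (hφ.differentiableAt_image hT hΩ hj) v⟩

theorem lineDifferentiableAt (hT : Function.Surjective T) (hΩ : IsOpen Ω)
    (hf : IsCylinder T Ω f) {j : J} (hj : j ∈ Ω) (v : J) : LineDifferentiableAt ℝ f j v :=
  let ⟨_, hL⟩ := hf.exists_hasLineDerivAt hT hΩ hj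
  (hL v).lineDifferentiableAt

theorem exists_lineDeriv_eq (hT : Function.Surjective T) (hΩ : IsOpen Ω)
    (hf : IsCylinder T Ω f) {j : J} (hj : j ∈ Ω) :
    ∃ L : E →L[ℝ] F, ∀ v, lineDeriv ℝ f j v = L (T v) :=
  let ⟨L, hL⟩ := hf.exists_hasLineDerivAt hT hΩ hj
  ⟨L, fun v => (hL v).lineDeriv⟩

/-- The hypothesis on `Λ` makes the `T`-part of the vector field an affine function of `T' j`. In
general `T'` must be finer than `T`, since total derivatives raise the order. -/
theorem lineDeriv_affine [FiniteDimensional ℝ E'] {T' : J →L[ℝ] E'} (hT : Function.Surjective T)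
    (hT' : Function.Surjective T') (h : ∀ j, T' j = 0 → T j = 0) (hΩ : IsOpen Ω)
    (hf : IsCylinder T Ω f) (c : J) (Λ : J →ₗ[ℝ] J) (hΛ : ∀ j, T' j = 0 → T (Λ j) = 0) :
    IsCylinder T' Ω (fun j => lineDeriv ℝ f j (c + Λ j)) := by
  obtain ⟨φ, hφ, hfφ⟩ := hf
  obtain ⟨p, hp⟩ := exists_continuousLinearMap_comp_eq hT' (T : J →ₗ[ℝ] E) h
  replace hp : ∀ j, T j = p (T' j) := hp
  obtain ⟨q, hq⟩ := exists_continuousLinearMap_comp_eq hT' ((T : J →ₗ[ℝ] E) ∘ₗ Λ) hΛ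
  replace hq : ∀ j, T (Λ j) = q (T' j) := hq
  refine ⟨fun y => fderiv ℝ φ (p y) (T c + q y), ContDiffOn.clm_apply ?_ ?_, fun j hj => ?_⟩
  · refine ContDiffOn.comp (t := T '' Ω)
      (hφ.fderiv_of_isOpen (isOpen_image_of_surjective hT hΩ) (by simp)) p.contDiff.contDiffOn ?_
    rintro _ ⟨j, hj, rfl⟩
    exact ⟨j, hj, hp j⟩
  · exact (contDiff_const.add q.contDiff).contDiffOn
  · have := hasLineDerivAt_of_eq_comp hΩ hfφ hj (hφ.differentiableAt_image hT hΩ hj) (c + Λ j)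
    refine this.lineDeriv.trans ?_
    change _ = fderiv ℝ φ (p (T' j)) (T c + q (T' j))
    rw [map_add, hq, hp j]

/-- The commutator of the derivatives along two affine vector fields. -/
theorem lineDeriv_comm (hT : Function.Surjective T) (hΩ : IsOpen Ω) (hf : IsCylinder T Ω f)
    (c d : J) (Λ M : J →ₗ[ℝ] J) {K : Type*} [NormedAddCommGroup K] [NormedSpace ℝ K]
    [FiniteDimensional ℝ K] {T' : J →L[ℝ] K} (hT' : Function.Surjective T')
    (hΛ : ∀ j, T' j = 0 → T (Λ j) = 0) (hM : ∀ j, T' j = 0 → T (M j) = 0) {j : J} (hj : j ∈ Ω) :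
    lineDeriv ℝ (fun i => lineDeriv ℝ f i (d + M i)) j (c + Λ j) + lineDeriv ℝ f j (Λ (d + M j)) =
    lineDeriv ℝ (fun i => lineDeriv ℝ f i (c + Λ i)) j (d + M j) +
      lineDeriv ℝ f j (M (c + Λ j)) := by
  obtain ⟨φ, hφ, hfφ⟩ := hf
  have hU := isOpen_image_of_surjective hT hΩ
  have hD : ∀ i ∈ Ω, ∀ v, lineDeriv ℝ f i v = fderiv ℝ φ (T i) (T v) := fun i hi v =>
    (hasLineDerivAt_of_eq_comp hΩ hfφ hi (hφ.differentiableAt_image hT hΩ hi) v).lineDeriv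
  have hφj : ContDiffAt ℝ ∞ φ (T j) := hφ.contDiffAt (hU.mem_nhds ⟨j, hj, rfl⟩)
  have hφ' : DifferentiableAt ℝ (fderiv ℝ φ) (T j) :=
    (hφj.fderiv_right (m := 1) (by norm_cast)).differentiableAt (by simp)
  -- Product rule: the direction itself varies affinely with the point, which adds a first-order
  -- term to the Hessian. The Hessian part is symmetric in the two fields, so only the first-order
  -- terms survive in the commutator.
  have key : ∀ (d : J) (M : J →ₗ[ℝ] J), (∀ j, T' j = 0 → T (M j) = 0) → ∀ v,
      lineDeriv ℝ (fun i => lineDeriv ℝ f i (d + M i)) j v =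
      fderiv ℝ (fderiv ℝ φ) (T j) (T v) (T (d + M j)) + fderiv ℝ φ (T j) (T (M v)) := by
    intro d M hM v
    obtain ⟨q, hq⟩ := exists_continuousLinearMap_comp_eq hT' ((T : J →ₗ[ℝ] E) ∘ₗ M) hM
    replace hq : ∀ j, T (M j) = q (T' j) := hq
    rw [lineDeriv_congr_of_isOpen hΩ (fun i hi => hD i hi (d + M i)) hj]
    have h1 : HasDerivAt (fun t : ℝ => fderiv ℝ φ (T (j + t • v)))
        (fderiv ℝ (fderiv ℝ φ) (T j) (T v)) 0 := by
      simpa [HasLineDerivAt] using hφ'.hasFDerivAt.hasLineDerivAt (T v)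
    have h2 : HasDerivAt (fun t : ℝ => T (d + M (j + t • v))) (T (M v)) 0 := by
      have : (fun t : ℝ => T (d + M (j + t • v))) = fun t : ℝ => T (d + M j) + t • T (M v) := by
        ext t; simp [add_assoc]
      rw [this]
      simpa using ((hasDerivAt_id (0 : ℝ)).smul_const (T (M v))).const_add (T (d + M j))
    have := h1.clm_apply h2
    have h3 := this.deriv
    simp only [zero_smul, add_zero] at h3
    exact h3
  rw [key d M hM, key c Λ hΛ, hD j hj, hD j hj]
  have hsymm := (hφj.isSymmSndFDerivAt (by simpa using (mod_cast le_top : ((2 : ℕ∞) : WithTop ℕ∞) ≤ ∞))) (T (c + Λ j)) (T (d + M j))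
  rw [hsymm]
  abel

end IsCylinder

/-- The Poincaré lemma for cylindrical `1`-forms. -/
theorem IsCylinder.exists_primitive {T : J →L[ℝ] E} (hT : Function.Surjective T) {Ω : Set J}
    (hΩ : IsOpen Ω) {θ : J → E →L[ℝ] ℝ} (hθ : IsCylinder T Ω θ)
    (hsymm : ∀ j ∈ Ω, ∀ u v, lineDeriv ℝ θ j u (T v) = lineDeriv ℝ θ j v (T u)) {j₀ : J}
    (hj₀ : j₀ ∈ Ω) :
    ∃ Ω' : Set J, IsOpen Ω' ∧ j₀ ∈ Ω' ∧ Ω' ⊆ Ω ∧ ∃ f : J → ℝ, IsCylinder T Ω' f ∧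
      ∀ j ∈ Ω', ∀ v, lineDeriv ℝ f j v = θ j (T v) := by
  obtain ⟨φ, hφ, hθφ⟩ := hθ
  have hU := isOpen_image_of_surjective hT hΩ
  obtain ⟨ε, hε, hball⟩ := Metric.isOpen_iff.1 hU (T j₀) ⟨j₀, hj₀, rfl⟩
  have hd : ∀ y ∈ Metric.ball (T j₀) ε, DifferentiableAt ℝ φ y := fun y hy =>
    (hφ.contDiffAt (hU.mem_nhds (hball hy))).differentiableAt (by simp)
  obtain ⟨g, hg⟩ := (convex_ball (T j₀) ε).exists_forall_hasFDerivAt_of_fderiv_symmetric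
    Metric.isOpen_ball (fun y hy => (hd y hy).differentiableWithinAt) (by
      intro y hy a b
      obtain ⟨j, hj, rfl⟩ := hball hy
      obtain ⟨u, rfl⟩ := hT a
      obtain ⟨v, rfl⟩ := hT b
      have h := hsymm j hj u v
      rwa [(hasLineDerivAt_of_eq_comp hΩ hθφ hj (hd _ hy) u).lineDeriv,
        (hasLineDerivAt_of_eq_comp hΩ hθφ hj (hd _ hy) v).lineDeriv] at h)
  have hΩ' : IsOpen (Ω ∩ T ⁻¹' Metric.ball (T j₀) ε) :=
    hΩ.inter (Metric.isOpen_ball.preimage T.continuous)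
  refine ⟨Ω ∩ T ⁻¹' Metric.ball (T j₀) ε, hΩ', ⟨hj₀, by simpa using hε⟩, Set.inter_subset_left,
    fun j => g (T j), ⟨g, ?_, fun _ _ => rfl⟩, ?_⟩
  -- The derivative of `g` is the smooth map `φ`, so `g` is smooth.
  · have hgC : ContDiffOn ℝ (∞ + 1) g (Metric.ball (T j₀) ε) := by
      rw [contDiffOn_succ_iff_hasFDerivWithinAt_of_uniqueDiffOn Metric.isOpen_ball.uniqueDiffOn]
      exact ⟨by simp, φ, hφ.mono hball, fun y hy => (hg y hy).hasFDerivWithinAt⟩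
    refine (hgC.of_le (by simp)).mono ?_
    rintro _ ⟨j, hj, rfl⟩
    exact hj.2
  · intro j hj v
    rw [(hasLineDerivAt_of_eq_comp (φ := g) hΩ' (fun _ _ => rfl) hj
      (hg _ hj.2).differentiableAt v).lineDeriv, (hg _ hj.2).fderiv, hθφ j hj.1]

end Cylinder

open scoped ContDiff Topology

namespace WaveCC

open TopologicalSpace (Opens)

noncomputable section

/-! ### Affine vector fields on the jet space -/

/-- `jetTrunc` as a continuous linear map. -/
def jetTruncL (n : ℕ) : Jet →L[ℝ] ℝ × ℝ × (Fin (n + 1) × Fin (n + 1) → ℝ) where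
  toFun := jetTrunc n
  map_add' _ _ := rfl
  map_smul' _ _ := rfl
  cont := by unfold jetTrunc xi eta w; fun_prop

theorem jetTruncL_eq_zero_iff {n : ℕ} {j : Jet} :
    jetTruncL n j = 0 ↔ j.1 = 0 ∧ j.2.1 = 0 ∧ ∀ k l, k ≤ n → l ≤ n → j.2.2 (k, l) = 0 := by
  refine ⟨fun h => ⟨congrArg Prod.fst h, congrArg (fun x => x.2.1) h, fun k l hk hl => ?_⟩, ?_⟩
  · exact congrFun (congrArg (fun x => x.2.2) h) (⟨k, by omega⟩, ⟨l, by omega⟩)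
  · rintro ⟨h1, h2, h3⟩
    refine Prod.ext h1 (Prod.ext h2 (funext fun p => h3 _ _ ?_ ?_)) <;> omega

theorem jetTruncL_eq_zero_of_le {m n : ℕ} (h : n ≤ m) {j : Jet} (hj : jetTruncL m j = 0) :
    jetTruncL n j = 0 := by
  rw [jetTruncL_eq_zero_iff] at hj ⊢
  exact ⟨hj.1, hj.2.1, fun k l hk hl => hj.2.2 k l (hk.trans h) (hl.trans h)⟩

theorem jetTruncL_surjective (n : ℕ) : Function.Surjective (jetTruncL n) := by
  rintro ⟨a, b, f⟩
  refine ⟨(a, b, fun p => if h : p.1 < n + 1 ∧ p.2 < n + 1 then f (⟨p.1, h.1⟩, ⟨p.2, h.2⟩) else 0),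
    Prod.ext rfl (Prod.ext rfl (funext fun p => ?_))⟩
  exact dif_pos ⟨p.1.2, p.2.2⟩

/-- The jet with `w_p = 1` whose other coordinates vanish. -/
def unitJet (p : ℕ × ℕ) : Jet := (0, 0, Pi.single p 1)

/-- An affine vector field on the jet space whose linear part respects the truncations. -/
structure JetField where
  base : Jet
  lin : Jet →ₗ[ℝ] Jet
  isLocal : ∀ n, ∃ m, ∀ j, jetTruncL m j = 0 → jetTruncL n (lin j) = 0

/-- The value of an affine vector field. -/
def JetField.val (v : JetField) (j : Jet) : Jet := v.base + v.lin j

/-- A constant vector field. -/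
def JetField.const (c : Jet) : JetField := ⟨c, 0, fun n => ⟨n, fun _ _ => map_zero _⟩⟩

@[simp] theorem JetField.const_val (c j : Jet) : (JetField.const c).val j = c := by
  simp [JetField.val, JetField.const]

@[simp] theorem JetField.const_lin (c : Jet) : (JetField.const c).lin = 0 := rfl

/-- The total derivative `D_ξ` as a vector field. -/
def fieldXi : JetField where
  base := (1, 0, 0)
  lin :=
    { toFun := fun j => (0, 0, fun p => j.2.2 (p.1 + 1, p.2))
      map_add' := fun _ _ => by ext <;> simp
      map_smul' := fun _ _ => by ext <;> simp }
  isLocal n := ⟨n + 1, fun j hj => by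
    rw [jetTruncL_eq_zero_iff] at hj ⊢
    exact ⟨rfl, rfl, fun k l hk hl => hj.2.2 _ _ (by omega) (by omega)⟩⟩

/-- The total derivative `D_η` as a vector field. -/
def fieldEta : JetField where
  base := (0, 1, 0)
  lin :=
    { toFun := fun j => (0, 0, fun p => j.2.2 (p.1, p.2 + 1))
      map_add' := fun _ _ => by ext <;> simp
      map_smul' := fun _ _ => by ext <;> simp }
  isLocal n := ⟨n + 1, fun j hj => by
    rw [jetTruncL_eq_zero_iff] at hj ⊢
    exact ⟨rfl, rfl, fun k l hk hl => hj.2.2 _ _ (by omega) (by omega)⟩⟩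

theorem fieldXi_lin (j : Jet) : fieldXi.lin j = (0, 0, fun p => j.2.2 (p.1 + 1, p.2)) := rfl

theorem fieldEta_lin (j : Jet) : fieldEta.lin j = (0, 0, fun p => j.2.2 (p.1, p.2 + 1)) := rfl

theorem fieldXi_val (j : Jet) : fieldXi.val j = (1, 0, fun p => j.2.2 (p.1 + 1, p.2)) := by
  simp [JetField.val, fieldXi_lin]; simp [fieldXi]

theorem fieldEta_val (j : Jet) : fieldEta.val j = (0, 1, fun p => j.2.2 (p.1, p.2 + 1)) := by
  simp [JetField.val, fieldEta_lin]; simp [fieldEta]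

/-! ### The algebra of differential functions on an open set -/

/-- Extension by zero. -/
def extendZero {Ω : Opens Jet} (f : Ω → ℝ) (j : Jet) : ℝ :=
  open Classical in if h : j ∈ Ω then f ⟨j, h⟩ else 0

theorem extendZero_of_mem {Ω : Opens Jet} (f : Ω → ℝ) {j : Jet} (h : j ∈ Ω) :
    extendZero f j = f ⟨j, h⟩ := dif_pos h

theorem isDiffFun_iff {Ω : Set Jet} {f : Jet → ℝ} :
    IsDiffFun Ω f ↔ ∃ n, IsCylinder (jetTruncL n) Ω f := Iff.rfl

theorem isCylinder_jetTruncL_mono {Ω : Set Jet} {m n : ℕ} (h : n ≤ m) {f : Jet → ℝ}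
    (hf : IsCylinder (jetTruncL n) Ω f) : IsCylinder (jetTruncL m) Ω f :=
  hf.mono (jetTruncL_surjective m) fun _ => jetTruncL_eq_zero_of_le h

theorem IsDiffFun.congr {Ω : Set Jet} {f g : Jet → ℝ} (hf : IsDiffFun Ω f)
    (h : ∀ j ∈ Ω, g j = f j) : IsDiffFun Ω g :=
  let ⟨n, hn⟩ := isDiffFun_iff.1 hf
  ⟨n, hn.congr h⟩

theorem IsDiffFun.exists_common {Ω : Set Jet} {f g : Jet → ℝ} (hf : IsDiffFun Ω f)
    (hg : IsDiffFun Ω g) :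
    ∃ n, IsCylinder (jetTruncL n) Ω f ∧ IsCylinder (jetTruncL n) Ω g := by
  obtain ⟨n, hn⟩ := isDiffFun_iff.1 hf
  obtain ⟨m, hm⟩ := isDiffFun_iff.1 hg
  exact ⟨max n m, isCylinder_jetTruncL_mono (le_max_left _ _) hn,
    isCylinder_jetTruncL_mono (le_max_right _ _) hm⟩

theorem IsDiffFun.add {Ω : Set Jet} {f g : Jet → ℝ} (hf : IsDiffFun Ω f) (hg : IsDiffFun Ω g) :
    IsDiffFun Ω (fun j => f j + g j) :=
  let ⟨n, h1, h2⟩ := hf.exists_common hg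
  ⟨n, h1.add h2⟩

theorem IsDiffFun.mul {Ω : Set Jet} {f g : Jet → ℝ} (hf : IsDiffFun Ω f) (hg : IsDiffFun Ω g) :
    IsDiffFun Ω (fun j => f j * g j) :=
  let ⟨n, h1, h2⟩ := hf.exists_common hg
  ⟨n, h1.mul h2⟩

theorem isDiffFun_const (Ω : Set Jet) (c : ℝ) : IsDiffFun Ω (fun _ => c) :=
  isDiffFun_iff.2 ⟨0, IsCylinder.const c⟩

/-- The differential functions on `Ω` as a subalgebra. -/
def diffSubalgebra (Ω : Opens Jet) : Subalgebra ℝ (Ω → ℝ) where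
  carrier := {f | IsDiffFun Ω (extendZero f)}
  mul_mem' hf hg := (IsDiffFun.mul hf hg).congr fun j hj => by simp [extendZero_of_mem _ hj]
  add_mem' hf hg := (IsDiffFun.add hf hg).congr fun j hj => by simp [extendZero_of_mem _ hj]
  algebraMap_mem' c := (isDiffFun_const _ c).congr fun j hj => by simp [extendZero_of_mem _ hj]

/-- The algebra of differential functions on `Ω`. -/
abbrev DiffAlg (Ω : Opens Jet) : Type := diffSubalgebra Ω

variable {Ω : Opens Jet}

namespace DiffAlg

/-- The element of `DiffAlg Ω` given by a function that is a differential function on `Ω`. -/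
def mk (f : Jet → ℝ) (hf : IsDiffFun Ω f) : DiffAlg Ω :=
  ⟨fun j => f j, hf.congr fun j hj => by simp [extendZero_of_mem _ hj]⟩

@[simp] theorem mk_apply (f : Jet → ℝ) (hf : IsDiffFun Ω f) (j : Ω) : (mk f hf).1 j = f j := rfl

/-- An element of `DiffAlg Ω` as a function on the jet space, zero outside of `Ω`. -/
def toFun (f : DiffAlg Ω) : Jet → ℝ := extendZero f.1

theorem toFun_apply (f : DiffAlg Ω) {j : Jet} (hj : j ∈ Ω) : f.toFun j = f.1 ⟨j, hj⟩ :=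
  extendZero_of_mem _ hj

theorem toFun_mk (f : Jet → ℝ) (hf : IsDiffFun Ω f) {j : Jet} (hj : j ∈ Ω) :
    (mk f hf).toFun j = f j := toFun_apply _ hj

theorem isDiffFun (f : DiffAlg Ω) : IsDiffFun Ω f.toFun := f.2

theorem ext_apply {f g : DiffAlg Ω} (h : ∀ j ∈ Ω, f.toFun j = g.toFun j) : f = g :=
  Subtype.ext (funext fun j => by simpa [toFun_apply _ j.2] using h j j.2)

@[simp] theorem toFun_add (f g : DiffAlg Ω) (j : Jet) : (f + g).toFun j = f.toFun j + g.toFun j := by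
  unfold toFun extendZero; split_ifs <;> simp

@[simp] theorem toFun_neg (f : DiffAlg Ω) (j : Jet) : (-f).toFun j = -f.toFun j := by
  unfold toFun extendZero; split_ifs <;> simp

@[simp] theorem toFun_sub (f g : DiffAlg Ω) (j : Jet) : (f - g).toFun j = f.toFun j - g.toFun j := by
  unfold toFun extendZero; split_ifs <;> simp

@[simp] theorem toFun_mul (f g : DiffAlg Ω) (j : Jet) : (f * g).toFun j = f.toFun j * g.toFun j := by
  unfold toFun extendZero; split_ifs <;> simp

@[simp] theorem toFun_smul (c : ℝ) (f : DiffAlg Ω) (j : Jet) : (c • f).toFun j = c * f.toFun j := by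
  unfold toFun extendZero; split_ifs <;> simp

@[simp] theorem toFun_zero (j : Jet) : (0 : DiffAlg Ω).toFun j = 0 := by
  unfold toFun extendZero; split_ifs <;> simp

@[simp] theorem toFun_sum {ι : Type*} (s : Finset ι) (f : ι → DiffAlg Ω) (j : Jet) :
    (∑ i ∈ s, f i).toFun j = ∑ i ∈ s, (f i).toFun j := by
  classical
  induction s using Finset.induction_on with
  | empty => simp
  | insert i s hi ih => simp [Finset.sum_insert hi, ih]

end DiffAlg

/-! ### Derivations along affine vector fields and their commutators -/

theorem IsDiffFun.lineDeriv_field {f : Jet → ℝ} (hf : IsDiffFun Ω f) (v : JetField) :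
    IsDiffFun Ω (fun j => lineDeriv ℝ f j (v.val j)) := by
  obtain ⟨n, hn⟩ := isDiffFun_iff.1 hf
  obtain ⟨m, hm⟩ := v.isLocal n
  exact isDiffFun_iff.2 ⟨max m n, hn.lineDeriv_affine (jetTruncL_surjective _)
    (jetTruncL_surjective _) (fun _ => jetTruncL_eq_zero_of_le (le_max_right _ _)) Ω.2 _ _
    (fun j hj => hm j (jetTruncL_eq_zero_of_le (le_max_left _ _) hj))⟩

theorem IsDiffFun.lineDifferentiableAt {f : Jet → ℝ} (hf : IsDiffFun Ω f) {j : Jet} (hj : j ∈ Ω)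
    (v : Jet) : LineDifferentiableAt ℝ f j v := by
  obtain ⟨n, hn⟩ := isDiffFun_iff.1 hf
  exact IsCylinder.lineDifferentiableAt (jetTruncL_surjective n) Ω.2 hn hj v

theorem lineDeriv_toFun_mk (f : Jet → ℝ) (hf : IsDiffFun Ω f) {j : Jet} (hj : j ∈ Ω) (v : Jet) :
    lineDeriv ℝ (DiffAlg.mk f hf).toFun j v = lineDeriv ℝ f j v :=
  lineDeriv_congr_of_isOpen Ω.2 (fun _ hi => DiffAlg.toFun_mk f hf hi) hj v

/-- The derivation of `DiffAlg Ω` along an affine vector field. -/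
def lie (v : JetField) : Derivation ℝ (DiffAlg Ω) (DiffAlg Ω) :=
  Derivation.mk'
    { toFun := fun f => DiffAlg.mk _ (f.isDiffFun.lineDeriv_field v)
      map_add' := fun f g => DiffAlg.ext_apply fun j hj => by
        rw [DiffAlg.toFun_add]
        simp only [DiffAlg.toFun_mk _ _ hj]
        have hf := (f.isDiffFun.lineDifferentiableAt hj (v.val j)).hasLineDerivAt
        have hg := (g.isDiffFun.lineDifferentiableAt hj (v.val j)).hasLineDerivAt
        refine HasLineDerivAt.lineDeriv (HasDerivAt.congr_of_eventuallyEq (HasDerivAt.add hf hg) ?_)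
        exact Filter.Eventually.of_forall fun t => DiffAlg.toFun_add _ _ _
      map_smul' := fun c f => DiffAlg.ext_apply fun j hj => by
        simp only [RingHom.id_apply, DiffAlg.toFun_smul, DiffAlg.toFun_mk _ _ hj]
        have hf := (f.isDiffFun.lineDifferentiableAt hj (v.val j)).hasLineDerivAt
        refine HasLineDerivAt.lineDeriv
          (HasDerivAt.congr_of_eventuallyEq (HasDerivAt.const_mul c hf) ?_)
        exact Filter.Eventually.of_forall fun t => DiffAlg.toFun_smul _ _ _ }
    fun f g => DiffAlg.ext_apply fun j hj => by
      simp only [LinearMap.coe_mk, AddHom.coe_mk, smul_eq_mul, DiffAlg.toFun_add, DiffAlg.toFun_mul,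
        DiffAlg.toFun_mk _ _ hj]
      have hf := (f.isDiffFun.lineDifferentiableAt hj (v.val j)).hasLineDerivAt
      have hg := (g.isDiffFun.lineDifferentiableAt hj (v.val j)).hasLineDerivAt
      have h := HasDerivAt.mul hf hg
      simp only [zero_smul, add_zero] at h
      rw [mul_comm (g.toFun j), add_comm]
      refine HasLineDerivAt.lineDeriv (HasDerivAt.congr_of_eventuallyEq h ?_)
      exact Filter.Eventually.of_forall fun t => DiffAlg.toFun_mul _ _ _

theorem lie_toFun (v : JetField) (f : DiffAlg Ω) {j : Jet} (hj : j ∈ Ω) :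
    (lie v f).toFun j = lineDeriv ℝ f.toFun j (v.val j) := DiffAlg.toFun_mk _ _ hj

theorem lie_mk_toFun (v : JetField) (f : Jet → ℝ) (hf : IsDiffFun Ω f) {j : Jet} (hj : j ∈ Ω) :
    (lie v (DiffAlg.mk f hf)).toFun j = lineDeriv ℝ f j (v.val j) := by
  rw [lie_toFun v _ hj, lineDeriv_toFun_mk _ _ hj]

/-- The commutator of two affine vector fields. -/
theorem lie_comm (u v : JetField) (f : DiffAlg Ω) {j : Jet} (hj : j ∈ Ω) :
    (lie u (lie v f)).toFun j + lineDeriv ℝ f.toFun j (u.lin (v.val j)) =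
      (lie v (lie u f)).toFun j + lineDeriv ℝ f.toFun j (v.lin (u.val j)) := by
  obtain ⟨n, hn⟩ := isDiffFun_iff.1 f.isDiffFun
  obtain ⟨m, hm⟩ := u.isLocal n
  obtain ⟨k, hk⟩ := v.isLocal n
  have hw : ∀ (w : JetField) (v : Jet), lineDeriv ℝ (lie w f).toFun j v =
      lineDeriv ℝ (fun i => lineDeriv ℝ f.toFun i (w.base + w.lin i)) j v := fun w v =>
    lineDeriv_congr_of_isOpen Ω.2 (fun i hi => lie_toFun w f hi) hj _
  rw [lie_toFun _ _ hj, lie_toFun _ _ hj, hw, hw]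
  exact hn.lineDeriv_comm (jetTruncL_surjective n) Ω.2 u.base v.base u.lin v.lin
    (jetTruncL_surjective (max m k))
    (fun i hi => hm i (jetTruncL_eq_zero_of_le (le_max_left _ _) hi))
    (fun i hi => hk i (jetTruncL_eq_zero_of_le (le_max_right _ _) hi)) hj

/-- `∂/∂w_p` as a derivation. -/
abbrev lieW (p : ℕ × ℕ) : Derivation ℝ (DiffAlg Ω) (DiffAlg Ω) := lie (.const (unitJet p))

theorem lineDeriv_zero_direction (f : Jet → ℝ) (j : Jet) : lineDeriv ℝ f j 0 = 0 := by
  simp [lineDeriv]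

/-- A constant field has no linear part, so one correction term of `lie_comm` drops out. For a total
derivative the other one is the partial derivative with the index lowered by one. -/
theorem lieW_lie (p : ℕ × ℕ) (v : JetField) (f : DiffAlg Ω) :
    lieW p (lie v f) = lie v (lieW p f) + lie (.const (v.lin (unitJet p))) f := by
  refine DiffAlg.ext_apply fun j hj => ?_
  have h := lie_comm (.const (unitJet p)) v f hj
  simp only [JetField.const_lin, LinearMap.zero_apply, lineDeriv_zero_direction, add_zero,
    JetField.const_val] at h
  rw [h, DiffAlg.toFun_add, lie_toFun (.const _) f hj, JetField.const_val]

theorem lie_const_zero (f : DiffAlg Ω) : lie (.const 0) f = 0 :=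
  DiffAlg.ext_apply fun j hj => by simp [lie_toFun _ _ hj, lineDeriv_zero_direction]

theorem fieldXi_lin_unitJet_succ (k l : ℕ) :
    fieldXi.lin (unitJet (k + 1, l)) = unitJet (k, l) := by
  refine Prod.ext rfl (Prod.ext rfl (funext fun p => ?_))
  simp [fieldXi_lin, unitJet, Pi.single_apply, Prod.ext_iff]

theorem fieldEta_lin_unitJet_succ (k l : ℕ) :
    fieldEta.lin (unitJet (k, l + 1)) = unitJet (k, l) := by
  refine Prod.ext rfl (Prod.ext rfl (funext fun p => ?_))
  simp [fieldEta_lin, unitJet, Pi.single_apply, Prod.ext_iff]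

/-- The two index shifts commute, so the correction terms of `lie_comm` cancel. -/
theorem lieXi_lieEta (f : DiffAlg Ω) :
    lie fieldXi (lie fieldEta f) = lie fieldEta (lie fieldXi f) := by
  refine DiffAlg.ext_apply fun j hj => ?_
  have h := lie_comm fieldXi fieldEta f hj
  have : fieldXi.lin (fieldEta.val j) = fieldEta.lin (fieldXi.val j) := by
    simp [fieldXi_lin, fieldEta_lin, fieldXi_val, fieldEta_val]
  rw [this] at h
  exact add_right_cancel h

theorem exists_lieW_eq_zero (f : DiffAlg Ω) :
    ∃ N, ∀ p : ℕ × ℕ, N ≤ p.1 ∨ N ≤ p.2 → lieW p f = 0 := by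
  obtain ⟨n, hn⟩ := isDiffFun_iff.1 f.isDiffFun
  refine ⟨n + 1, fun p hp => DiffAlg.ext_apply fun j hj => ?_⟩
  obtain ⟨L, hL⟩ := hn.exists_lineDeriv_eq (jetTruncL_surjective n) Ω.2 hj
  have : jetTruncL n (unitJet p) = 0 := by
    rw [jetTruncL_eq_zero_iff]
    refine ⟨rfl, rfl, fun k l hk hl => Pi.single_eq_of_ne ?_ _⟩
    rintro rfl
    omega
  rw [lie_toFun _ _ hj, JetField.const_val, hL, this]
  simp

end

end WaveCC

namespace WaveCC

noncomputable section

/-! ### Higher Euler operators -/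

section Euler

variable {M : Type*} [AddCommGroup M] [Module ℝ M]

/-- The higher Euler operator `∑_k (-D)^k P_{l+1+k}`, truncated at `N`. -/
def higherEuler (D : Module.End ℝ M) (P : ℕ → Module.End ℝ M) (N l : ℕ) (f : M) : M :=
  ∑ k ∈ Finset.range N, ((-D) ^ k) (P (l + 1 + k) f)

theorem apply_neg_pow (D : Module.End ℝ M) (k : ℕ) (f : M) :
    D (((-D) ^ k) f) = -((-D) ^ (k + 1)) f := by
  rw [pow_succ', Module.End.mul_apply, LinearMap.neg_apply, neg_neg]

theorem neg_pow_apply (D : Module.End ℝ M) (k : ℕ) (f : M) :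
    ((-D) ^ k) (D f) = -((-D) ^ (k + 1)) f := by
  rw [pow_succ, Module.End.mul_apply, LinearMap.neg_apply, map_neg, neg_neg]

variable {D : Module.End ℝ M} {P : ℕ → Module.End ℝ M} {N : ℕ} {f : M}

/-- Telescoping. When f = D g + C w_1, the functions ∂g/∂w_l satisfy the same recursion for l ≥ 1;
this is why the higher Euler operators serve below as the partial derivatives of a primitive. -/
theorem higherEuler_add_apply_higherEuler (h : ∀ m, N ≤ m → P m f = 0) (l : ℕ) :
    higherEuler D P N l f + D (higherEuler D P N (l + 1) f) = P (l + 1) f := by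
  have key := Finset.sum_range_sub' (fun k => ((-D) ^ k) (P (l + 1 + k) f)) N
  simp only [h (l + 1 + N) (by omega), map_zero, sub_zero, pow_zero, Module.End.one_apply,
    add_zero, Finset.sum_sub_distrib] at key
  rw [← key, higherEuler, higherEuler, map_sum, sub_eq_add_neg, ← Finset.sum_neg_distrib]
  congr 1
  refine Finset.sum_congr rfl fun k _ => ?_
  rw [apply_neg_pow, add_right_comm (l + 1) 1 k, add_assoc (l + 1) k 1]

theorem higherEuler_eq_zero (h : ∀ m, N ≤ m → P m f = 0) {l : ℕ} (hl : N ≤ l) :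
    higherEuler D P N l f = 0 :=
  Finset.sum_eq_zero fun k _ => by rw [h _ (by omega), map_zero]

/-- The commutation rule turns the sum into a telescoping one with end terms `P 0 f` and (-D)^N `P N
f`, both zero. -/
theorem higherEuler_zero_apply (h0 : P 0 f = 0) (hN : P N f = 0)
    (hcomm : ∀ l, P (l + 1) (D f) = D (P (l + 1) f) + P l f) :
    higherEuler D P N 0 (D f) = 0 := by
  have key := Finset.sum_range_sub' (fun k => ((-D) ^ k) (P k f)) N
  simp only [hN, h0, map_zero, sub_zero] at key
  rw [← key, higherEuler]
  refine Finset.sum_congr rfl fun k _ => ?_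
  rw [zero_add, add_comm 1 k, hcomm, map_add, neg_pow_apply]
  abel

theorem higherEuler_add_apply (l : ℕ) (g : M) :
    higherEuler D P N l (f + g) = higherEuler D P N l f + higherEuler D P N l g := by
  simp [higherEuler, Finset.sum_add_distrib]

/-- Functions in the image of the total divergence are annihilated by the Euler operator. -/
theorem higherEuler_add_higherEuler_eq_zero {X Y : Module.End ℝ M} (hXY : Commute X Y)
    {P : ℕ → ℕ → Module.End ℝ M} {u v : M} (h : X u + Y v = 0)
    (hX : ∀ k l, P (k + 1) l (X u) = X (P (k + 1) l u) + P k l u)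
    (hY : ∀ k l, P k (l + 1) (Y v) = Y (P k (l + 1) v) + P k l v)
    (hu : ∀ l, P N l u = 0) (hv : ∀ k, P k N v = 0) :
    higherEuler Y (P 0) N 0 u + higherEuler X (fun k => P k 0) N 0 v = 0 := by
  -- For fixed `l` the sum over `k` telescopes down to `k = 0`, leaving one summand of the Euler
  -- operator of `u`; `hv'` does the same for `v` with the roles of `k` and `l` exchanged, where
  -- commutativity of `X` and `Y` is needed.
  have hu' : ∀ l, ∑ k ∈ Finset.range N, ((-Y) ^ l) (((-X) ^ k) (P (k + 1) (l + 1) (X u))) =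
      ((-Y) ^ l) (P 0 (l + 1) u) := fun l => by
    have key := Finset.sum_range_sub' (fun k => ((-Y) ^ l) (((-X) ^ k) (P k (l + 1) u))) N
    simp only [hu, map_zero, sub_zero, pow_zero, Module.End.one_apply] at key
    rw [← key]
    refine Finset.sum_congr rfl fun k _ => ?_
    rw [hX, map_add, neg_pow_apply, map_add, map_neg]
    abel
  have hv' : ∀ k, ∑ l ∈ Finset.range N, ((-Y) ^ l) (((-X) ^ k) (P (k + 1) (l + 1) (Y v))) =
      ((-X) ^ k) (P (k + 1) 0 v) := fun k => by
    have hc : ∀ l g, ((-Y) ^ l) (((-X) ^ k) g) = ((-X) ^ k) (((-Y) ^ l) g) := fun l g =>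
      LinearMap.congr_fun ((hXY.symm.neg_left.neg_right.pow_pow l k).eq) g
    have key := Finset.sum_range_sub' (fun l => ((-X) ^ k) (((-Y) ^ l) (P (k + 1) l v))) N
    simp only [hv, map_zero, sub_zero, pow_zero, Module.End.one_apply] at key
    rw [← key]
    refine Finset.sum_congr rfl fun l _ => ?_
    rw [hY, hc, map_add, neg_pow_apply, map_add, map_neg]
    abel
  have h0 : ∑ l ∈ Finset.range N, ∑ k ∈ Finset.range N,
      ((-Y) ^ l) (((-X) ^ k) (P (k + 1) (l + 1) (X u + Y v))) = 0 := by
    simp [h]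
  simp only [map_add, Finset.sum_add_distrib, hu'] at h0
  rw [Finset.sum_comm] at h0
  simp only [hv'] at h0
  simpa only [higherEuler, zero_add, add_comm 1] using h0

/-- The Helmholtz conditions. -/
theorem helmholtz {h : ℕ → M} (hP : ∀ k l, P k (P l f) = P l (P k f))
    (h0 : ∀ l, P 0 (h l) = 0) (h0' : ∀ k, P k (h 0) = 0)
    (hrec : ∀ l, h l + D (h (l + 1)) = P (l + 1) f)
    (hcomm : ∀ k l, P (k + 1) (D (h l)) = D (P (k + 1) (h l)) + P k (h l))
    (hN : ∀ k, N ≤ k → h k = 0) (hK : ∀ k l, N ≤ k → P k (h l) = 0) (k l : ℕ) :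
    P k (h l) = P l (h k) := by
  -- Downward induction on `k`: from `k ≥ N` on both sides vanish. Applying `P (k + 1)` and `P (l +
  -- 1)` to the two recursions and subtracting, symmetry at (k+1, l) and (k+1, l+1) leaves symmetry
  -- at (k, l+1).
  have key : ∀ d k l, N ≤ k + d → P k (h l) = P l (h k) := by
    intro d
    induction d with
    | zero => intro k l hk; rw [hK k l hk, hN k hk, map_zero]
    | succ d ih =>
      intro k l hk
      cases l with
      | zero => rw [h0, h0']
      | succ l =>
        have e1 := congrArg (P (k + 1)) (hrec l)
        have e2 := congrArg (P (l + 1)) (hrec k)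
        rw [map_add, hcomm] at e1 e2
        rw [ih (k + 1) l (by omega), ih (k + 1) (l + 1) (by omega), hP, ← e2] at e1
        refine sub_eq_zero.1 (Eq.trans ?_ (sub_eq_zero.2 e1))
        abel
  exact key N k l (by omega)

end Euler

end

end WaveCC

open scoped ContDiff Topology

namespace WaveCC

open TopologicalSpace (Opens)

noncomputable section

variable {Ω : Opens Jet}

/-! ### Coordinates as elements of the algebra -/

theorem isDiffFun_w (Ω : Set Jet) (p : ℕ × ℕ) : IsDiffFun Ω (fun j => j.2.2 p) := by
  refine isDiffFun_iff.2 ⟨max p.1 p.2, fun y => y.2.2 (⟨p.1, by omega⟩, ⟨p.2, by omega⟩), ?_,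
    fun _ _ => rfl⟩
  fun_prop

/-- The coordinate `w_p` as an element of the algebra of differential functions. -/
def coordW (p : ℕ × ℕ) : DiffAlg Ω := .mk (fun j => j.2.2 p) (isDiffFun_w Ω p)

theorem coordW_toFun (p : ℕ × ℕ) {j : Jet} (hj : j ∈ Ω) : (coordW p : DiffAlg Ω).toFun j = j.2.2 p :=
  DiffAlg.toFun_mk _ _ hj

theorem DiffAlg.toFun_one {j : Jet} (hj : j ∈ Ω) : (1 : DiffAlg Ω).toFun j = 1 :=
  DiffAlg.toFun_apply _ hj

theorem lineDeriv_w (p : ℕ × ℕ) (j v : Jet) : lineDeriv ℝ (fun j : Jet => j.2.2 p) j v = v.2.2 p := by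
  have : HasDerivAt (fun t : ℝ => (j + t • v).2.2 p) (v.2.2 p) 0 := by
    simpa using ((hasDerivAt_id (0 : ℝ)).mul_const (v.2.2 p)).const_add (j.2.2 p)
  exact this.deriv

theorem lie_coordW_toFun (v : JetField) (p : ℕ × ℕ) {j : Jet} (hj : j ∈ Ω) :
    (lie v (coordW p : DiffAlg Ω)).toFun j = (v.val j).2.2 p := by
  rw [coordW, lie_mk_toFun _ _ _ hj, lineDeriv_w]

theorem lieW_coordW (p q : ℕ × ℕ) :
    lieW q (coordW p : DiffAlg Ω) = if p = q then 1 else 0 := by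
  refine DiffAlg.ext_apply fun j hj => ?_
  rw [lie_coordW_toFun _ _ hj, JetField.const_val]
  split_ifs with h <;> simp [unitJet, h, DiffAlg.toFun_one hj]

theorem lieW_comm (p q : ℕ × ℕ) (f : DiffAlg Ω) : lieW p (lieW q f) = lieW q (lieW p f) := by
  rw [lieW_lie]
  simp [lie_const_zero]

/-! ### Functions of the coordinates on one axis -/

/-- One independent variable `t` together with the derivatives of `w` with respect to `t`, and the
corresponding total derivative. -/
structure Axis where
  t : Jet →L[ℝ] ℝ
  idx : ℕ → ℕ × ℕ
  field : JetField
  idx_injective : Function.Injective idx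
  idx_le : ∀ l, (idx l).1 ≤ l ∧ (idx l).2 ≤ l
  t_base : t field.base = 1
  w_base : ∀ p, field.base.2.2 p = 0
  t_unitJet : ∀ p, t (unitJet p) = 0
  t_lin : ∀ j, t (field.lin j) = 0
  w_lin : ∀ l j, (field.lin j).2.2 (idx l) = j.2.2 (idx (l + 1))
  lin_unitJet_succ : ∀ l, field.lin (unitJet (idx (l + 1))) = unitJet (idx l)
  t_eq_zero : ∀ n j, jetTruncL n j = 0 → t j = 0

namespace Axis

/-- The axis `ξ, w_{10}, w_{20}, …`. -/
def xiAxis : Axis where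
  t := ContinuousLinearMap.fst ℝ _ _
  idx k := (k, 0)
  field := fieldXi
  idx_injective _ _ h := congrArg Prod.fst h
  idx_le l := ⟨le_rfl, Nat.zero_le l⟩
  t_base := rfl
  w_base _ := rfl
  t_unitJet _ := rfl
  t_lin _ := rfl
  w_lin _ _ := rfl
  lin_unitJet_succ l := fieldXi_lin_unitJet_succ l 0
  t_eq_zero _ _ h := (jetTruncL_eq_zero_iff.1 h).1

/-- The axis `η, w_{01}, w_{02}, …`. -/
def etaAxis : Axis where
  t := (ContinuousLinearMap.fst ℝ _ _).comp (ContinuousLinearMap.snd ℝ _ _)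
  idx l := (0, l)
  field := fieldEta
  idx_injective _ _ h := congrArg Prod.snd h
  idx_le l := ⟨Nat.zero_le l, le_rfl⟩
  t_base := rfl
  w_base _ := rfl
  t_unitJet _ := rfl
  t_lin _ := rfl
  w_lin _ _ := rfl
  lin_unitJet_succ l := fieldEta_lin_unitJet_succ 0 l
  t_eq_zero _ _ h := (jetTruncL_eq_zero_iff.1 h).2.1

variable (α : Axis)

/-- The coordinates on the axis up to the order `r`. -/
def trunc (r : ℕ) : Jet →L[ℝ] ℝ × (Fin r → ℝ) where
  toFun j := (α.t j, fun l => j.2.2 (α.idx (l + 1)))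
  map_add' _ _ := by ext <;> simp
  map_smul' _ _ := by ext <;> simp
  cont := by have := α.t.continuous; fun_prop

theorem trunc_apply (r : ℕ) (j : Jet) :
    α.trunc r j = (α.t j, fun l : Fin r => j.2.2 (α.idx (l + 1))) := rfl

theorem trunc_eq_zero_iff {r : ℕ} {j : Jet} :
    α.trunc r j = 0 ↔ α.t j = 0 ∧ ∀ l < r, j.2.2 (α.idx (l + 1)) = 0 := by
  rw [trunc_apply, Prod.mk_eq_zero, funext_iff]
  exact and_congr_right fun _ => ⟨fun h l hl => h ⟨l, hl⟩, fun h l => h l l.2⟩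

theorem unitJet_idx (k l : ℕ) : (unitJet (α.idx k)).2.2 (α.idx l) = if l = k then 1 else 0 := by
  simp [unitJet, Pi.single_apply, α.idx_injective.eq_iff]

theorem trunc_eq_sum (r : ℕ) (v : Jet) : α.trunc r v = α.t v • α.trunc r α.field.base +
    ∑ k ∈ Finset.range r, v.2.2 (α.idx (k + 1)) • α.trunc r (unitJet (α.idx (k + 1))) := by
  simp only [← map_smul, ← map_sum, ← map_add]
  rw [← sub_eq_zero, ← map_sub, trunc_eq_zero_iff]
  refine ⟨by simp [α.t_base, α.t_unitJet], fun l hl => ?_⟩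
  have h2 : ∀ (s : Finset ℕ) (f : ℕ → Jet) p, (∑ k ∈ s, f k).2.2 p = ∑ k ∈ s, (f k).2.2 p := by
    intro s f p
    rw [Prod.snd_sum, Prod.snd_sum, Finset.sum_apply]
  simp [h2, α.w_base, unitJet_idx, hl]

theorem trunc_surjective (r : ℕ) : Function.Surjective (α.trunc r) := by
  rintro ⟨a, f⟩
  refine ⟨a • α.field.base + ∑ k : Fin r, f k • unitJet (α.idx (k + 1)), Prod.ext ?_ ?_⟩
  · simp [trunc_apply, α.t_base, α.t_unitJet]
  · ext l
    simp [trunc_apply, α.w_base, unitJet_idx, Prod.snd_sum, Fin.val_inj]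

variable {α}

theorem isCylinder_trunc_mono {Ω : Set Jet} {f : Jet → ℝ} {r s : ℕ} (h : r ≤ s)
    (hf : IsCylinder (α.trunc r) Ω f) : IsCylinder (α.trunc s) Ω f :=
  hf.mono (α.trunc_surjective s) fun j hj => by
    rw [trunc_eq_zero_iff] at hj ⊢
    exact ⟨hj.1, fun l hl => hj.2 l (hl.trans_le h)⟩

theorem isDiffFun_of_isCylinder {Ω : Set Jet} {f : Jet → ℝ} {r : ℕ}
    (hf : IsCylinder (α.trunc r) Ω f) : IsDiffFun Ω f :=
  isDiffFun_iff.2 ⟨r, hf.mono (jetTruncL_surjective r) fun j hj => by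
    rw [trunc_eq_zero_iff]
    refine ⟨α.t_eq_zero r j hj, fun l hl => ?_⟩
    exact (jetTruncL_eq_zero_iff.1 hj).2.2 _ _ ((α.idx_le (l + 1)).1.trans hl)
      ((α.idx_le (l + 1)).2.trans hl)⟩

theorem lineDeriv_eq_sum {f : Jet → ℝ} {r : ℕ} (hf : IsCylinder (α.trunc r) Ω f) {j : Jet}
    (hj : j ∈ Ω) (v : Jet) : lineDeriv ℝ f j v = α.t v * lineDeriv ℝ f j α.field.base +
      ∑ k ∈ Finset.range r, v.2.2 (α.idx (k + 1)) * lineDeriv ℝ f j (unitJet (α.idx (k + 1))) := by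
  obtain ⟨L, hL⟩ := hf.exists_lineDeriv_eq (α.trunc_surjective r) Ω.2 hj
  simp only [hL]
  conv_lhs => rw [α.trunc_eq_sum r v]
  simp

theorem lineDeriv_eq_zero {f : Jet → ℝ} {r : ℕ} (hf : IsCylinder (α.trunc r) Ω f) {j : Jet}
    (hj : j ∈ Ω) {v : Jet} (hv : α.trunc r v = 0) : lineDeriv ℝ f j v = 0 := by
  obtain ⟨L, hL⟩ := hf.exists_lineDeriv_eq (α.trunc_surjective r) Ω.2 hj
  rw [hL, hv, map_zero]

variable (α) in
/-- The functions of finitely many coordinates on the axis, as a submodule. -/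
def pure (Ω : Opens Jet) : Submodule ℝ (DiffAlg Ω) where
  carrier := {f | ∃ r, IsCylinder (α.trunc r) Ω f.toFun}
  add_mem' := by
    rintro f g ⟨r, hr⟩ ⟨s, hs⟩
    refine ⟨max r s, ((isCylinder_trunc_mono (le_max_left r s) hr).add
      (isCylinder_trunc_mono (le_max_right r s) hs)).congr fun j _ => by simp⟩
  zero_mem' := ⟨0, (IsCylinder.const 0).congr fun j _ => by simp⟩
  smul_mem' := by
    rintro c f ⟨r, hr⟩
    exact ⟨r, ((IsCylinder.const c).mul hr).congr fun j _ => by simp⟩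

theorem mem_pure {f : DiffAlg Ω} : f ∈ α.pure Ω ↔ ∃ r, IsCylinder (α.trunc r) Ω f.toFun := Iff.rfl

theorem lie_const_mem_pure {f : DiffAlg Ω} (hf : f ∈ α.pure Ω) (c : Jet) :
    lie (.const c) f ∈ α.pure Ω := by
  obtain ⟨r, hr⟩ := hf
  exact ⟨r, (hr.lineDeriv_affine (α.trunc_surjective r) (α.trunc_surjective r) (fun _ h => h)
    Ω.2 c 0 (fun _ _ => map_zero _)).congr fun j hj => lie_toFun _ _ hj⟩

theorem lie_field_mem_pure {f : DiffAlg Ω} (hf : f ∈ α.pure Ω) : lie α.field f ∈ α.pure Ω := by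
  obtain ⟨r, hr⟩ := hf
  refine ⟨r + 1, (hr.lineDeriv_affine (α.trunc_surjective r) (α.trunc_surjective (r + 1)) ?_
    Ω.2 α.field.base α.field.lin ?_).congr fun j hj => lie_toFun _ _ hj⟩
  · intro j hj
    rw [trunc_eq_zero_iff] at hj ⊢
    exact ⟨hj.1, fun l hl => hj.2 l (by omega)⟩
  · intro j hj
    rw [trunc_eq_zero_iff] at hj ⊢
    exact ⟨α.t_lin j, fun l hl => by rw [α.w_lin, hj.2 (l + 1) (by omega)]⟩

/-! ### The total derivative and the Euler operators on one axis -/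

variable (α) in
/-- The total derivative along the axis as a linear map. -/
def D (Ω : Opens Jet) : Module.End ℝ (DiffAlg Ω) := (lie α.field).toLinearMap

variable (α) in
/-- The partial derivatives along the axis as linear maps. -/
def P (Ω : Opens Jet) (l : ℕ) : Module.End ℝ (DiffAlg Ω) := (lieW (α.idx l)).toLinearMap

@[simp] theorem D_apply (f : DiffAlg Ω) : α.D Ω f = lie α.field f := rfl

@[simp] theorem P_apply (l : ℕ) (f : DiffAlg Ω) : α.P Ω l f = lieW (α.idx l) f := rfl

theorem neg_D_pow_mem {S : Submodule ℝ (DiffAlg Ω)} (hS : ∀ f ∈ S, lie α.field f ∈ S) (k : ℕ)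
    {f : DiffAlg Ω} (hf : f ∈ S) : ((-α.D Ω) ^ k) f ∈ S := by
  induction k with
  | zero => simpa
  | succ k ih =>
    rw [pow_succ', Module.End.mul_apply, LinearMap.neg_apply]
    exact S.neg_mem (hS _ ih)

theorem higherEuler_mem {S : Submodule ℝ (DiffAlg Ω)} (hS : ∀ f ∈ S, lie α.field f ∈ S)
    {f : DiffAlg Ω} (hf : ∀ l, lieW (α.idx l) f ∈ S) (N l : ℕ) :
    higherEuler (α.D Ω) (α.P Ω) N l f ∈ S :=
  S.sum_mem fun k _ => neg_D_pow_mem hS k (hf _)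

theorem higherEuler_mem_pure {f : DiffAlg Ω} (hf : f ∈ α.pure Ω) (N l : ℕ) :
    higherEuler (α.D Ω) (α.P Ω) N l f ∈ α.pure Ω :=
  higherEuler_mem (fun _ => lie_field_mem_pure) (fun _ => lie_const_mem_pure hf _) N l

theorem lieW_eq_zero_of_trunc {f : DiffAlg Ω} {r : ℕ} (hf : IsCylinder (α.trunc r) Ω f.toFun)
    {p : ℕ × ℕ} (hp : ∀ l < r, p ≠ α.idx (l + 1)) : lieW p f = 0 := by
  refine DiffAlg.ext_apply fun j hj => ?_
  rw [lie_toFun _ _ hj, JetField.const_val, DiffAlg.toFun_zero, lineDeriv_eq_zero hf hj]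
  rw [trunc_eq_zero_iff]
  exact ⟨α.t_unitJet p, fun l hl => Pi.single_eq_of_ne (hp l hl).symm _⟩

theorem lieW_idx_zero {f : DiffAlg Ω} (hf : f ∈ α.pure Ω) : lieW (α.idx 0) f = 0 := by
  obtain ⟨r, hr⟩ := hf
  exact lieW_eq_zero_of_trunc hr fun l _ h => by simpa using α.idx_injective h

theorem lieW_lie_field (l : ℕ) (f : DiffAlg Ω) : lieW (α.idx (l + 1)) (lie α.field f) =
    lie α.field (lieW (α.idx (l + 1)) f) + lieW (α.idx l) f := by
  rw [lieW_lie, α.lin_unitJet_succ]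

theorem w_val (l : ℕ) (j : Jet) : (α.field.val j).2.2 (α.idx l) = j.2.2 (α.idx (l + 1)) := by
  simp [JetField.val, α.w_base, α.w_lin]

theorem t_val (j : Jet) : α.t (α.field.val j) = 1 := by
  simp [JetField.val, α.t_base, α.t_lin]

theorem exists_common_trunc {f : ℕ → DiffAlg Ω} (hf : ∀ l, f l ∈ α.pure Ω) (n : ℕ) :
    ∃ r, ∀ l < n, IsCylinder (α.trunc r) Ω (f l).toFun := by
  choose r hr using fun l => mem_pure.1 (hf l)
  exact ⟨(Finset.range n).sup r, fun l hl =>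
    isCylinder_trunc_mono (Finset.le_sup (Finset.mem_range.2 hl)) (hr l)⟩

/-- Local exactness: a function of the coordinates on the axis whose Euler operator with respect
to `w_1` is a constant `C` has the form `D g + C w_1` locally. -/
theorem exists_local_primitive {f : DiffAlg Ω} (hf : f ∈ α.pure Ω) {N : ℕ}
    (hN : ∀ m, N ≤ m → lieW (α.idx m) f = 0) {C : ℝ}
    (hC : ∀ j ∈ Ω, (higherEuler (α.D Ω) (α.P Ω) N 0 f).toFun j = C) {j₀ : Jet} (hj₀ : j₀ ∈ Ω) :
    ∃ Ω' : Set Jet, IsOpen Ω' ∧ j₀ ∈ Ω' ∧ Ω' ⊆ Ω ∧ ∃ g : Jet → ℝ,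
      (∃ r, IsCylinder (α.trunc r) Ω' g) ∧
      ∀ j ∈ Ω', f.toFun j = lineDeriv ℝ g j (α.field.val j) + C * j.2.2 (α.idx 1) := by
  set h : ℕ → DiffAlg Ω := fun l => higherEuler (α.D Ω) (α.P Ω) N l f with hh
  have hpure : ∀ l, h l ∈ α.pure Ω := fun l => higherEuler_mem_pure hf N l
  have hhN : ∀ l, N ≤ l → h l = 0 := fun l hl => higherEuler_eq_zero hN hl
  have hrec : ∀ l, h l + lie α.field (h (l + 1)) = lieW (α.idx (l + 1)) f := fun l =>
    higherEuler_add_apply_higherEuler hN l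
  have hh0 : h 0 = C • 1 := DiffAlg.ext_apply fun j hj => by
    simpa [DiffAlg.toFun_one hj] using hC j hj
  obtain ⟨r₁, hr₁⟩ := hf
  obtain ⟨r₂, hr₂⟩ := exists_common_trunc hpure N
  -- One order `r` for `f` and all `h l`; `N + 1 ≤ r` ensures that w_1 is among the coordinates and
  -- that `h l = 0` for `l ≥ r`.
  obtain ⟨r, h1r, h2r, hNr⟩ : ∃ r, r₁ ≤ r ∧ r₂ ≤ r ∧ N + 1 ≤ r :=
    ⟨max r₁ (max r₂ (N + 1)), by omega, by omega, by omega⟩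
  have hfr := isCylinder_trunc_mono h1r hr₁
  have hhr : ∀ l, IsCylinder (α.trunc r) Ω (h l).toFun := fun l => by
    rcases lt_or_ge l N with hl | hl
    · exact isCylinder_trunc_mono h2r (hr₂ l hl)
    · exact (IsCylinder.const 0).congr fun j _ => by rw [hhN l hl, DiffAlg.toFun_zero]
  have hsymm : ∀ k l, lieW (α.idx k) (h l) = lieW (α.idx l) (h k) :=
    helmholtz (D := α.D Ω) (P := α.P Ω) (N := r + 1) (f := f) (fun k l => lieW_comm _ _ _)
      (fun l => lieW_idx_zero (hpure l)) (fun k => by simp [hh0]) hrec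
      (fun k l => lieW_lie_field k _) (fun k hk => hhN k (by omega))
      (fun k l hk => lieW_eq_zero_of_trunc (hhr l) fun m hm hkm => by
        have := α.idx_injective hkm
        omega)
  -- If D g = f - C w_1 and ∂g/∂w_l = h_l for l ≥ 1, then `a` is forced to be ∂g/∂t.
  set a : DiffAlg Ω := f - C • coordW (α.idx 1) -
    ∑ l ∈ Finset.range r, coordW (α.idx (l + 2)) * h (l + 1) with ha
  have hw : ∀ l < r, IsCylinder (α.trunc r) Ω (coordW (α.idx (l + 1)) : DiffAlg Ω).toFun :=
    fun l hl => (IsCylinder.linear ((ContinuousLinearMap.proj ⟨l, hl⟩).comp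
      (ContinuousLinearMap.snd ℝ ℝ (Fin r → ℝ))) fun j => rfl).congr fun j hj => coordW_toFun _ hj
  have har : IsCylinder (α.trunc r) Ω a.toFun := by
    refine ((hfr.add ((IsCylinder.const C).mul (hw 0 (by omega))).neg).add
      (IsCylinder.sum (Finset.range r) (f := fun l j => (coordW (α.idx (l + 2)) * h (l + 1)).toFun j)
      fun l hl => ?_).neg).congr fun j hj => by simp [ha, sub_eq_add_neg]
    -- The last summand contains w_{r+1}, which is beyond order `r`, but its factor `h r` is zero.
    rcases lt_or_ge (l + 1) r with hlr | hlr
    · exact ((hw (l + 1) hlr).mul (hhr (l + 1))).congr fun j _ => by simp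
    · exact (IsCylinder.const 0).congr fun j _ => by rw [hhN (l + 1) (by omega)]; simp
  -- The dt ∧ dw part of closedness. Differentiating the factor w_{k+1} in `a` produces `h k`; for
  -- `k = 0` it comes from C w_1 instead. The Helmholtz symmetry then turns the remaining sum into
  -- that of D h_{k+1}.
  have hPa : ∀ k < r, lieW (α.idx (k + 1)) a = lie (.const α.field.base) (h (k + 1)) := by
    intro k hk
    have e1 : lieW (α.idx (k + 1)) a = lieW (α.idx (k + 1)) f - h k -
        ∑ l ∈ Finset.range r, coordW (α.idx (l + 2)) * lieW (α.idx (k + 1)) (h (l + 1)) := by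
      simp only [ha, map_sub, map_sum, Derivation.leibniz, Derivation.map_smul, lieW_coordW,
        α.idx_injective.eq_iff, smul_eq_mul, Finset.sum_add_distrib]
      cases k with
      | zero => simp [hh0]
      | succ k =>
        simp [show k < r by omega]
        abel
    have e2 : lie α.field (h (k + 1)) = lie (.const α.field.base) (h (k + 1)) +
        ∑ l ∈ Finset.range r, coordW (α.idx (l + 2)) * lieW (α.idx (k + 1)) (h (l + 1)) := by
      refine DiffAlg.ext_apply fun j hj => ?_
      rw [lie_toFun _ _ hj, lineDeriv_eq_sum (hhr (k + 1)) hj, t_val, one_mul, DiffAlg.toFun_add,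
        lie_toFun _ _ hj, JetField.const_val, DiffAlg.toFun_sum]
      congr 1
      refine Finset.sum_congr rfl fun l _ => ?_
      rw [w_val, DiffAlg.toFun_mul, coordW_toFun _ hj, hsymm, lie_toFun _ _ hj, JetField.const_val]
    rw [e1, ← hrec, e2]
    abel
  -- The prospective differential dg = a dt + ∑ h_l dw_l.
  set θ : Jet → (ℝ × (Fin r → ℝ)) →L[ℝ] ℝ := fun j =>
    a.toFun j • ContinuousLinearMap.fst ℝ ℝ (Fin r → ℝ) + ∑ l : Fin r, (h (l + 1)).toFun j •
      (ContinuousLinearMap.proj l).comp (ContinuousLinearMap.snd ℝ ℝ (Fin r → ℝ)) with hθ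
  have hθr : IsCylinder (α.trunc r) Ω θ :=
    (har.smul (IsCylinder.const _)).add (IsCylinder.sum _ fun l _ =>
      (hhr _).smul (IsCylinder.const _))
  have hθv : ∀ j v, θ j (α.trunc r v) = α.t v * a.toFun j +
      ∑ l ∈ Finset.range r, v.2.2 (α.idx (l + 1)) * (h (l + 1)).toFun j := by
    intro j v
    rw [Finset.sum_range]
    simp [hθ, trunc_apply, mul_comm]
  have hdθ : ∀ j ∈ Ω, ∀ u v, lineDeriv ℝ θ j u (α.trunc r v) = α.t v * lineDeriv ℝ a.toFun j u +
      ∑ l ∈ Finset.range r, v.2.2 (α.idx (l + 1)) * lineDeriv ℝ (h (l + 1)).toFun j u := by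
    intro j hj u v
    have d0 : HasDerivAt (fun t : ℝ => θ (j + t • u)) (lineDeriv ℝ θ j u) 0 :=
      (hθr.lineDifferentiableAt (α.trunc_surjective r) Ω.2 hj u).hasLineDerivAt
    have d1 := d0.clm_apply (hasDerivAt_const (0 : ℝ) (α.trunc r v))
    simp only [hθv, map_zero, add_zero] at d1
    have d2 : HasDerivAt (fun t : ℝ => a.toFun (j + t • u)) (lineDeriv ℝ a.toFun j u) 0 :=
      (a.isDiffFun.lineDifferentiableAt hj u).hasLineDerivAt
    have d3 : ∀ l ∈ Finset.range r, HasDerivAt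
        (fun t : ℝ => v.2.2 (α.idx (l + 1)) * (h (l + 1)).toFun (j + t • u))
        (v.2.2 (α.idx (l + 1)) * lineDeriv ℝ (h (l + 1)).toFun j u) 0 := fun l _ =>
      HasDerivAt.const_mul _ ((h (l + 1)).isDiffFun.lineDifferentiableAt hj u).hasLineDerivAt
    exact d1.unique ((d2.const_mul _).add (HasDerivAt.fun_sum d3))
  obtain ⟨Ω', ho, hj, hs, g, hg, hgθ⟩ := hθr.exists_primitive (α.trunc_surjective r) Ω.2
    (fun j hj u v => by
      have e1 : ∀ k < r, lineDeriv ℝ a.toFun j (unitJet (α.idx (k + 1))) =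
          lineDeriv ℝ (h (k + 1)).toFun j α.field.base := fun k hk => by
        simpa [lie_toFun _ _ hj] using congrArg (fun b => b.toFun j) (hPa k hk)
      have e2 : ∀ k l, lineDeriv ℝ (h k).toFun j (unitJet (α.idx l)) =
          lineDeriv ℝ (h l).toFun j (unitJet (α.idx k)) := fun k l => by
        simpa [lie_toFun _ _ hj] using congrArg (fun b => b.toFun j) (hsymm l k)
      have e3 : ∀ u, lineDeriv ℝ a.toFun j u = α.t u * lineDeriv ℝ a.toFun j α.field.base +
          ∑ k ∈ Finset.range r, u.2.2 (α.idx (k + 1)) *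
            lineDeriv ℝ (h (k + 1)).toFun j α.field.base := fun u => by
        rw [lineDeriv_eq_sum har hj]
        congr 1
        exact Finset.sum_congr rfl fun k hk => by rw [e1 k (Finset.mem_range.1 hk)]
      rw [hdθ j hj, hdθ j hj, e3 u, e3 v]
      simp only [lineDeriv_eq_sum (hhr _) hj u, lineDeriv_eq_sum (hhr _) hj v, mul_add,
        Finset.sum_add_distrib, Finset.mul_sum]
      have e4 : ∑ k ∈ Finset.range r, ∑ l ∈ Finset.range r, v.2.2 (α.idx (k + 1)) *
            (u.2.2 (α.idx (l + 1)) *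
              lineDeriv ℝ (h (k + 1)).toFun j (unitJet (α.idx (l + 1)))) =
          ∑ k ∈ Finset.range r, ∑ l ∈ Finset.range r, u.2.2 (α.idx (k + 1)) *
            (v.2.2 (α.idx (l + 1)) *
              lineDeriv ℝ (h (k + 1)).toFun j (unitJet (α.idx (l + 1)))) := by
        rw [Finset.sum_comm]
        refine Finset.sum_congr rfl fun k _ => Finset.sum_congr rfl fun l _ => ?_
        rw [e2]
        ring
      have e5 : ∀ u v : Jet, ∑ k ∈ Finset.range r, v.2.2 (α.idx (k + 1)) *
            (α.t u * lineDeriv ℝ (h (k + 1)).toFun j α.field.base) =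
          ∑ k ∈ Finset.range r, α.t u * (v.2.2 (α.idx (k + 1)) *
            lineDeriv ℝ (h (k + 1)).toFun j α.field.base) := fun u v =>
        Finset.sum_congr rfl fun k _ => by ring
      rw [e4, e5, e5]
      ring) hj₀
  refine ⟨Ω', ho, hj, hs, g, ⟨r, hg⟩, fun j hj => ?_⟩
  have hjΩ : j ∈ Ω := hs hj
  rw [hgθ j hj, hθv, t_val, one_mul]
  simp [ha, w_val, coordW_toFun _ hjΩ]

end Axis

end

end WaveCC

open scoped ContDiff Topology

namespace WaveCC

open TopologicalSpace (Opens)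

noncomputable section

variable {Ω : Opens Jet}

/-! ### The total derivatives as directional derivatives -/

theorem pW_eq_lineDeriv (k l : ℕ) (f : Jet → ℝ) (j : Jet) :
    pW k l f j = lineDeriv ℝ f j (unitJet (k, l)) := by
  have h : ∀ t : ℝ, j + t • unitJet (k, l) =
      (j.1, j.2.1, Function.update j.2.2 (k, l) (w k l j + t)) := by
    intro t
    refine Prod.ext (by simp [unitJet]) (Prod.ext (by simp [unitJet]) (funext fun p => ?_))
    rcases eq_or_ne p (k, l) with rfl | hp <;> simp [unitJet, w, *]
  simp only [lineDeriv, h, pW]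
  rw [deriv_comp_const_add (fun t => f (j.1, j.2.1, Function.update j.2.2 (k, l) t)), add_zero]

theorem pXi_eq_lineDeriv (f : Jet → ℝ) (j : Jet) : pXi f j = lineDeriv ℝ f j (1, 0, 0) := by
  have h : ∀ t : ℝ, j + t • ((1, 0, 0) : Jet) = (xi j + t, j.2.1, j.2.2) := fun t => by
    refine Prod.ext (by simp [xi]) (Prod.ext (by simp) (by simp))
  simp only [lineDeriv, h, pXi]
  rw [deriv_comp_const_add (fun t => f (t, j.2.1, j.2.2)), add_zero]

theorem pEta_eq_lineDeriv (f : Jet → ℝ) (j : Jet) : pEta f j = lineDeriv ℝ f j (0, 1, 0) := by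
  have h : ∀ t : ℝ, j + t • ((0, 1, 0) : Jet) = (j.1, eta j + t, j.2.2) := fun t => by
    refine Prod.ext (by simp) (Prod.ext (by simp [eta]) (by simp))
  simp only [lineDeriv, h, pEta]
  rw [deriv_comp_const_add (fun t => f (j.1, t, j.2.2)), add_zero]

theorem jetTruncL_eq_sum (n : ℕ) (v : Jet) : jetTruncL n v =
    v.1 • jetTruncL n (1, 0, 0) + v.2.1 • jetTruncL n (0, 1, 0) +
    ∑ p ∈ Finset.range (n + 1) ×ˢ Finset.range (n + 1), v.2.2 p • jetTruncL n (unitJet p) := by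
  simp only [← map_smul, ← map_sum, ← map_add]
  rw [← sub_eq_zero, ← map_sub, jetTruncL_eq_zero_iff]
  refine ⟨by simp [Prod.fst_sum, unitJet], by simp [Prod.snd_sum, Prod.fst_sum, unitJet],
    fun k l hk hl => ?_⟩
  have h : (∑ p ∈ Finset.range (n + 1) ×ˢ Finset.range (n + 1),
      v.2.2 p • (Pi.single p 1 : ℕ × ℕ → ℝ)) (k, l) = v.2.2 (k, l) := by
    rw [Finset.sum_apply, Finset.sum_eq_single (k, l)]
    · simp
    · intro p _ hp
      simp [Pi.single_eq_of_ne hp.symm]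
    · intro hkl
      simp at hkl
      omega
  simpa [Prod.snd_sum, unitJet, sub_eq_zero] using h.symm

/-- Beyond the order of `f` the derivatives vanish, so the `finsum` has finite support and takes its
intended value rather than the default 0. -/
theorem lineDeriv_eq_finsum {f : Jet → ℝ} (hf : IsDiffFun Ω f) {j : Jet} (hj : j ∈ Ω) (v : Jet) :
    lineDeriv ℝ f j v = v.1 * lineDeriv ℝ f j (1, 0, 0) + v.2.1 * lineDeriv ℝ f j (0, 1, 0) +
      ∑ᶠ p : ℕ × ℕ, v.2.2 p * lineDeriv ℝ f j (unitJet p) := by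
  obtain ⟨n, hn⟩ := isDiffFun_iff.1 hf
  obtain ⟨L, hL⟩ := hn.exists_lineDeriv_eq (jetTruncL_surjective n) Ω.2 hj
  rw [finsum_eq_sum_of_support_subset (s := Finset.range (n + 1) ×ˢ Finset.range (n + 1))]
  · simp only [hL]
    conv_lhs => rw [jetTruncL_eq_sum n v]
    simp
  · intro p hp
    by_contra hpn
    refine hp ?_
    have : jetTruncL n (unitJet p) = 0 := by
      rw [jetTruncL_eq_zero_iff]
      refine ⟨rfl, rfl, fun k l hk hl => Pi.single_eq_of_ne ?_ _⟩
      rintro rfl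
      simp at hpn
      omega
    simp [hL, this]

theorem DXi_eq_lineDeriv {f : Jet → ℝ} (hf : IsDiffFun Ω f) {j : Jet} (hj : j ∈ Ω) :
    DXi f j = lineDeriv ℝ f j (fieldXi.val j) := by
  rw [lineDeriv_eq_finsum hf hj, DXi, pXi_eq_lineDeriv, fieldXi_val]
  simp [pW_eq_lineDeriv, w]

theorem DEta_eq_lineDeriv {f : Jet → ℝ} (hf : IsDiffFun Ω f) {j : Jet} (hj : j ∈ Ω) :
    DEta f j = lineDeriv ℝ f j (fieldEta.val j) := by
  rw [lineDeriv_eq_finsum hf hj, DEta, pEta_eq_lineDeriv, fieldEta_val]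
  simp [pW_eq_lineDeriv, w]

theorem Axis.lineDeriv_eq_finsum {α : Axis} {f : Jet → ℝ} {r : ℕ}
    (hf : IsCylinder (α.trunc r) Ω f) {j : Jet} (hj : j ∈ Ω) (v : Jet) :
    lineDeriv ℝ f j v = α.t v * lineDeriv ℝ f j α.field.base +
      ∑ᶠ k : ℕ, v.2.2 (α.idx k) * lineDeriv ℝ f j (unitJet (α.idx k)) := by
  have h0 : ∀ k, (∀ l < r, k ≠ l + 1) → lineDeriv ℝ f j (unitJet (α.idx k)) = 0 := fun k hk =>
    Axis.lineDeriv_eq_zero hf hj (by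
      rw [Axis.trunc_eq_zero_iff]
      refine ⟨α.t_unitJet _, fun l hl => ?_⟩
      rw [α.unitJet_idx, if_neg (hk l hl).symm])
  -- The extra index `0` is the direction of w_{00}, on which functions on the axis do not depend.
  rw [Axis.lineDeriv_eq_sum hf hj, finsum_eq_sum_of_support_subset (s := Finset.range (r + 1)),
    Finset.sum_range_succ', h0 0 (by omega), mul_zero, add_zero]
  intro k hk
  by_contra hkr
  refine hk ?_
  simp only [h0 k fun l hl => by simp at hkr; omega, mul_zero]

theorem sDXi_eq_lineDeriv {f : Jet → ℝ} {r : ℕ} (hf : IsCylinder (Axis.xiAxis.trunc r) Ω f)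
    {j : Jet} (hj : j ∈ Ω) : sDXi f j = lineDeriv ℝ f j (Axis.xiAxis.field.val j) := by
  rw [Axis.lineDeriv_eq_finsum hf hj, sDXi, pXi_eq_lineDeriv, Axis.t_val, one_mul]
  simp only [Axis.w_val, pW_eq_lineDeriv]
  rfl

theorem sDEta_eq_lineDeriv {f : Jet → ℝ} {r : ℕ} (hf : IsCylinder (Axis.etaAxis.trunc r) Ω f)
    {j : Jet} (hj : j ∈ Ω) : sDEta f j = lineDeriv ℝ f j (Axis.etaAxis.field.val j) := by
  rw [Axis.lineDeriv_eq_finsum hf hj, sDEta, pEta_eq_lineDeriv, Axis.t_val, one_mul]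
  simp only [Axis.w_val, pW_eq_lineDeriv]
  rfl

theorem totalDiv_mk {P : (Jet → ℝ) × (Jet → ℝ)} (h1 : IsDiffFun Ω P.1) (h2 : IsDiffFun Ω P.2)
    {j : Jet} (hj : j ∈ Ω) : totalDiv P j =
      (lie fieldXi (.mk P.1 h1 : DiffAlg Ω) + lie fieldEta (.mk P.2 h2 : DiffAlg Ω)).toFun j := by
  rw [DiffAlg.toFun_add, lie_mk_toFun _ _ _ hj, lie_mk_toFun _ _ _ hj, totalDiv,
    DXi_eq_lineDeriv h1 hj, DEta_eq_lineDeriv h2 hj]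

theorem DiffAlg.mk_toFun (f : DiffAlg Ω) : DiffAlg.mk f.toFun f.isDiffFun = f :=
  ext_apply fun _ hj => toFun_mk _ _ hj

/-! ### Functions vanishing on solutions -/

theorem add_smul_mem_solutionManifold {j v : Jet} (hj : j ∈ solutionManifold)
    (hv : v ∈ solutionManifold) (t : ℝ) : j + t • v ∈ solutionManifold := fun k l => by
  have h1 := hj k l
  have h2 := hv k l
  simp only [w] at h1 h2 ⊢
  simp [h1, h2]

/-- The differential functions that vanish on solutions. -/
def solIdeal (Ω : Opens Jet) : Submodule ℝ (DiffAlg Ω) where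
  carrier := {f | ∀ j ∈ Ω, j ∈ solutionManifold → f.toFun j = 0}
  add_mem' hf hg j hj hs := by simp [hf j hj hs, hg j hj hs]
  zero_mem' j _ _ := by simp
  smul_mem' c f hf j hj hs := by simp [hf j hj hs]

/-- The solution manifold is a linear subspace, so a tangent direction keeps the whole line inside
it and `f` is zero along that line near the point. -/
theorem lie_mem_solIdeal {v : JetField} (hv : ∀ j ∈ solutionManifold, v.val j ∈ solutionManifold)
    {f : DiffAlg Ω} (hf : f ∈ solIdeal Ω) : lie v f ∈ solIdeal Ω := by
  intro j hj hs
  rw [lie_toFun _ _ hj]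
  refine HasLineDerivAt.lineDeriv
    (HasDerivAt.congr_of_eventuallyEq (hasDerivAt_const (0 : ℝ) (0 : ℝ)) ?_)
  filter_upwards [eventually_add_smul_mem Ω.2 hj (v.val j)] with t ht
  exact hf _ ht (add_smul_mem_solutionManifold hs (hv j hs) t)

theorem lieXi_mem_solIdeal {f : DiffAlg Ω} (hf : f ∈ solIdeal Ω) : lie fieldXi f ∈ solIdeal Ω :=
  lie_mem_solIdeal (fun j hj k l => by rw [fieldXi_val]; exact hj (k + 1) l) hf

theorem lieEta_mem_solIdeal {f : DiffAlg Ω} (hf : f ∈ solIdeal Ω) : lie fieldEta f ∈ solIdeal Ω :=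
  lie_mem_solIdeal (fun j hj k l => by rw [fieldEta_val]; exact hj k (l + 1)) hf

/-- Only the directions w_{k0} and w_{0l} are tangent to the solution manifold; the Euler operators
of the two axes use no others. -/
theorem lieW_mem_solIdeal {f : DiffAlg Ω} (hf : f ∈ solIdeal Ω) {p : ℕ × ℕ}
    (hp : p.1 = 0 ∨ p.2 = 0) : lieW p f ∈ solIdeal Ω :=
  lie_mem_solIdeal (fun j _ k l => by
    rw [JetField.const_val]
    refine Pi.single_eq_of_ne ?_ _
    rintro rfl
    simp at hp) hf

/-! ### The Euler operators of a pair -/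

theorem higherEuler_eq_of_le {M : Type*} [AddCommGroup M] [Module ℝ M] (D : Module.End ℝ M)
    {P : ℕ → Module.End ℝ M} {N N' : ℕ} (h : N ≤ N') {f : M} (hf : ∀ m, N ≤ m → P m f = 0)
    (l : ℕ) : higherEuler D P N' l f = higherEuler D P N l f := by
  refine (Finset.sum_subset (Finset.range_mono h) fun k _ hk => ?_).symm
  rw [hf _ (by simp at hk; omega), map_zero]

namespace Axis

variable {α : Axis}

variable (α) in
/-- The Euler operator with respect to `w_1` on the axis, truncated at `N`. -/
def euler (N : ℕ) (f : DiffAlg Ω) : DiffAlg Ω := higherEuler (α.D Ω) (α.P Ω) N 0 f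

theorem lieW_eq_zero_of_lt {f : DiffAlg Ω} {r : ℕ} (hf : IsCylinder (α.trunc r) Ω f.toFun)
    (m : ℕ) (hm : r + 1 ≤ m) : lieW (α.idx m) f = 0 :=
  lieW_eq_zero_of_trunc hf fun l hl h => by
    have := α.idx_injective h
    omega

/-- The Euler operator of `D g + C w_1` is `C`. -/
theorem euler_toFun_of_eq {f : DiffAlg Ω} {N : ℕ} (hN : ∀ m, N ≤ m → lieW (α.idx m) f = 0)
    {g : Jet → ℝ} {r : ℕ} (hg : IsCylinder (α.trunc r) Ω g) {C : ℝ}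
    (h : ∀ j ∈ Ω, f.toFun j = lineDeriv ℝ g j (α.field.val j) + C * j.2.2 (α.idx 1))
    {j : Jet} (hj : j ∈ Ω) : (α.euler N f).toFun j = C := by
  set G : DiffAlg Ω := .mk g (isDiffFun_of_isCylinder hg)
  have hG : IsCylinder (α.trunc r) Ω G.toFun := hg.congr fun j hj => DiffAlg.toFun_mk _ _ hj
  have hf : f = lie α.field G + C • coordW (α.idx 1) := DiffAlg.ext_apply fun j hj => by
    rw [h j hj, DiffAlg.toFun_add, lie_mk_toFun _ _ _ hj, DiffAlg.toFun_smul, coordW_toFun _ hj]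
  -- `N` bounds the order of `f` but not that of the primitive, so the truncation is enlarged to
  -- suit both.
  have h1 : higherEuler (α.D Ω) (α.P Ω) (max N (r + 1)) 0 (lie α.field G) = 0 :=
    higherEuler_zero_apply (lieW_idx_zero ⟨r, hG⟩)
      (lieW_eq_zero_of_lt hG _ (le_max_right _ _)) fun l => lieW_lie_field l G
  have h2 : higherEuler (α.D Ω) (α.P Ω) (max N (r + 1)) 0 (C • coordW (α.idx 1)) =
      (C • 1 : DiffAlg Ω) := by
    rw [higherEuler, Finset.sum_eq_single 0]
    · simp [lieW_coordW]
    · intro k _ hk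
      rw [P_apply, Derivation.map_smul, lieW_coordW, if_neg, smul_zero, map_zero]
      exact fun h => hk (by have := α.idx_injective h; omega)
    · intro h
      simp at h
  have h3 : α.euler N f = C • 1 := by
    rw [euler, ← higherEuler_eq_of_le (α.D Ω) (P := α.P Ω) (le_max_left N (r + 1)) hN, hf, higherEuler_add_apply, h1,
      h2, zero_add]
  rw [h3, DiffAlg.toFun_smul, DiffAlg.toFun_one hj, mul_one]

/-- The divergence along a transversal vector field is compensated up to the Euler operator. -/
theorem lie_add_lie_field {f : DiffAlg Ω} {r : ℕ} (hf : IsCylinder (α.trunc r) Ω f.toFun)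
    {v : JetField} {c : ℕ → ℕ × ℕ} (hvt : ∀ j, α.t (v.val j) = 0)
    (hv : ∀ l j, (v.val j).2.2 (α.idx l) = j.2.2 (c l))
    (hc : ∀ l j, (α.field.val j).2.2 (c l) = j.2.2 (c (l + 1))) :
    lie v f + lie α.field (-∑ l ∈ Finset.range r,
      coordW (c (l + 1)) * higherEuler (α.D Ω) (α.P Ω) (r + 1) (l + 1) f) =
    coordW (c 1) * α.euler (r + 1) f := by
  have hN := lieW_eq_zero_of_lt hf
  set h : ℕ → DiffAlg Ω := fun l => higherEuler (α.D Ω) (α.P Ω) (r + 1) l f with hh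
  have hrec : ∀ l, h l + lie α.field (h (l + 1)) = lieW (α.idx (l + 1)) f := fun l =>
    higherEuler_add_apply_higherEuler hN l
  -- Truncation at `r + 1` only gives `h (r + 1) = 0` at once; the telescoping sum of `r` terms
  -- needs `h r = 0`.
  have hr : h r = 0 := by
    have h1 : h (r + 1) = 0 := higherEuler_eq_zero hN le_rfl
    have h2 := hrec r
    rwa [h1, map_zero, add_zero, hN _ le_rfl] at h2
  have e1 : lie v f = ∑ l ∈ Finset.range r, coordW (c (l + 1)) * lieW (α.idx (l + 1)) f := by
    refine DiffAlg.ext_apply fun j hj => ?_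
    rw [lie_toFun _ _ hj, lineDeriv_eq_sum hf hj, hvt, zero_mul, zero_add, DiffAlg.toFun_sum]
    refine Finset.sum_congr rfl fun l _ => ?_
    rw [hv, DiffAlg.toFun_mul, coordW_toFun _ hj, lie_toFun _ _ hj, JetField.const_val]
  have e2 : ∀ l, lie α.field (coordW (c l) : DiffAlg Ω) = coordW (c (l + 1)) := fun l =>
    DiffAlg.ext_apply fun j hj => by rw [lie_coordW_toFun _ _ hj, hc, coordW_toFun _ hj]
  -- Integration by parts: after the recursion replaces ∂f/∂w_{l+1}, the terms with D h_{l+1} cancel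
  -- and the rest telescopes to c_1 h_0.
  have key := Finset.sum_range_sub' (fun l => coordW (c (l + 1)) * h l) r
  rw [hr, mul_zero, sub_zero] at key
  change _ + lie α.field (-∑ l ∈ Finset.range r, coordW (c (l + 1)) * h (l + 1)) = _ * h 0
  rw [← key, e1, map_neg, map_sum, ← Finset.sum_neg_distrib, ← Finset.sum_add_distrib]
  refine Finset.sum_congr rfl fun l _ => ?_
  rw [Derivation.leibniz, e2, ← hrec l]
  simp only [smul_eq_mul]
  ring

end Axis

/-! ### Locality of the Euler operator -/

/-- Restriction to a smaller open set. -/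
def restrict {Ω Ω' : Opens Jet} (h : Ω' ≤ Ω) (f : DiffAlg Ω) : DiffAlg Ω' :=
  .mk f.toFun (let ⟨n, hn⟩ := isDiffFun_iff.1 f.isDiffFun; ⟨n, hn.mono_set h⟩)

theorem restrict_toFun {Ω' : Opens Jet} (h : Ω' ≤ Ω) (f : DiffAlg Ω) {j : Jet} (hj : j ∈ Ω') :
    (restrict h f).toFun j = f.toFun j := DiffAlg.toFun_mk _ _ hj

theorem restrict_lie {Ω' : Opens Jet} (h : Ω' ≤ Ω) (v : JetField) (f : DiffAlg Ω) :
    restrict h (lie v f) = lie v (restrict h f) :=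
  DiffAlg.ext_apply fun j hj => by
    rw [restrict_toFun h _ hj, lie_toFun _ _ (h hj), restrict, lie_mk_toFun _ _ _ hj]

theorem restrict_zero {Ω' : Opens Jet} (h : Ω' ≤ Ω) : restrict h (0 : DiffAlg Ω) = 0 :=
  DiffAlg.ext_apply fun j hj => by rw [restrict_toFun h _ hj]; simp

/-- Needed because a local form is known only near a point, while the Euler operators are taken on
all of `Ω`. -/
theorem Axis.restrict_euler {α : Axis} {Ω' : Opens Jet} (h : Ω' ≤ Ω) (N : ℕ) (f : DiffAlg Ω) :
    restrict h (α.euler N f) = α.euler N (restrict h f) := by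
  have hpow : ∀ (k : ℕ) (f : DiffAlg Ω),
      restrict h (((-α.D Ω) ^ k) f) = ((-α.D Ω') ^ k) (restrict h f) := by
    intro k
    induction k with
    | zero => intro f; simp
    | succ k ih =>
      intro f
      rw [pow_succ, pow_succ, Module.End.mul_apply, Module.End.mul_apply, ih]
      congr 1
      refine DiffAlg.ext_apply fun j hj => ?_
      rw [restrict_toFun h _ hj, LinearMap.neg_apply, LinearMap.neg_apply, DiffAlg.toFun_neg,
        DiffAlg.toFun_neg, D_apply, D_apply, ← restrict_lie, restrict_toFun h _ hj]
  refine DiffAlg.ext_apply fun j hj => ?_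
  rw [restrict_toFun h _ hj, euler, euler, higherEuler, higherEuler, DiffAlg.toFun_sum,
    DiffAlg.toFun_sum]
  refine Finset.sum_congr rfl fun k _ => ?_
  rw [← restrict_toFun h _ hj, hpow, P_apply, P_apply, restrict_lie]

end

end WaveCC

open scoped ContDiff Topology

namespace WaveCC

open TopologicalSpace (Opens)
open Axis

noncomputable section

variable {Ω : Opens Jet}

/-! ### Trivial conserved currents and the Euler operators -/

theorem euler_add_euler_eq_zero_of_null {u v : DiffAlg Ω}
    (h : lie fieldXi u + lie fieldEta v = 0) :
    ∃ N₀, ∀ N, N₀ ≤ N → etaAxis.euler N u + xiAxis.euler N v = 0 := by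
  obtain ⟨N₁, hN₁⟩ := exists_lieW_eq_zero u
  obtain ⟨N₂, hN₂⟩ := exists_lieW_eq_zero v
  refine ⟨max N₁ N₂, fun N hN => ?_⟩
  have hXY : Commute (xiAxis.D Ω) (etaAxis.D Ω) := LinearMap.ext fun f => lieXi_lieEta f
  exact higherEuler_add_higherEuler_eq_zero hXY
    (P := fun k l => (lieW (k, l)).toLinearMap) h
    (fun k l => by
      change lieW (k + 1, l) (lie fieldXi u) = lie fieldXi (lieW (k + 1, l) u) + lieW (k, l) u
      rw [lieW_lie, fieldXi_lin_unitJet_succ])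
    (fun k l => by
      change lieW (k, l + 1) (lie fieldEta v) = lie fieldEta (lieW (k, l + 1) v) + lieW (k, l) v
      rw [lieW_lie, fieldEta_lin_unitJet_succ])
    (fun l => hN₁ (N, l) (Or.inl ((le_max_left _ _).trans hN)))
    (fun k => hN₂ (k, N) (Or.inr ((le_max_right _ _).trans hN)))

theorem euler_add (α : Axis) (N : ℕ) (f g : DiffAlg Ω) :
    α.euler N (f + g) = α.euler N f + α.euler N g := higherEuler_add_apply 0 g

theorem euler_eq_of_le (α : Axis) {N N' : ℕ} (h : N ≤ N') {f : DiffAlg Ω}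
    (hf : ∀ m, N ≤ m → lieW (α.idx m) f = 0) : α.euler N' f = α.euler N f :=
  higherEuler_eq_of_le (α.D Ω) (P := α.P Ω) h hf 0

theorem euler_mem_solIdeal {α : Axis} (hD : ∀ f ∈ solIdeal Ω, lie α.field f ∈ solIdeal Ω)
    (hα : ∀ l, (α.idx l).1 = 0 ∨ (α.idx l).2 = 0) {f : DiffAlg Ω} (hf : f ∈ solIdeal Ω) (N : ℕ) :
    α.euler N f ∈ solIdeal Ω := by
  rw [euler]
  exact higherEuler_mem hD (fun l => lieW_mem_solIdeal hf (hα l)) N 0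

theorem euler_etaAxis_mem_solIdeal {f : DiffAlg Ω} (hf : f ∈ solIdeal Ω) (N : ℕ) :
    etaAxis.euler N f ∈ solIdeal Ω := by
  refine euler_mem_solIdeal (fun f hf => ?_) (fun l => Or.inl rfl) hf N
  change lie fieldEta f ∈ solIdeal Ω
  exact lieEta_mem_solIdeal hf

theorem euler_xiAxis_mem_solIdeal {f : DiffAlg Ω} (hf : f ∈ solIdeal Ω) (N : ℕ) :
    xiAxis.euler N f ∈ solIdeal Ω := by
  refine euler_mem_solIdeal (fun f hf => ?_) (fun l => Or.inr rfl) hf N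
  change lie fieldXi f ∈ solIdeal Ω
  exact lieXi_mem_solIdeal hf

theorem IsNullDivergence.exists_lie_add_lie_eq_zero {P : (Jet → ℝ) × (Jet → ℝ)}
    (hP : IsNullDivergence Ω P) : ∃ u v : DiffAlg Ω, (∀ j ∈ Ω, u.toFun j = P.1 j) ∧
      (∀ j ∈ Ω, v.toFun j = P.2 j) ∧ lie fieldXi u + lie fieldEta v = 0 :=
  ⟨.mk P.1 hP.fst, .mk P.2 hP.snd, fun _ hj => DiffAlg.toFun_mk _ _ hj,
    fun _ hj => DiffAlg.toFun_mk _ _ hj, DiffAlg.ext_apply fun j hj => by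
      rw [← totalDiv_mk hP.fst hP.snd hj, hP.div_eq_zero j hj, DiffAlg.toFun_zero]⟩

/-- The null divergence contributes zero and the part vanishing on solutions contributes an element
of `solIdeal`. -/
theorem euler_add_euler_of_trivial {P : (Jet → ℝ) × (Jet → ℝ)}
    (hP : IsTrivialConservedCurrent Ω P) {F G : DiffAlg Ω} (hF : ∀ j ∈ Ω, P.1 j = F.toFun j)
    (hG : ∀ j ∈ Ω, P.2 j = G.toFun j) {N : ℕ} (hFN : ∀ m, N ≤ m → lieW (etaAxis.idx m) F = 0)
    (hGN : ∀ m, N ≤ m → lieW (xiAxis.idx m) G = 0) :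
    etaAxis.euler N F + xiAxis.euler N G ∈ solIdeal Ω := by
  obtain ⟨-, P', P'', h', h'', hsum⟩ := hP
  have hex : ∀ f : Jet → ℝ, IsDiffFun Ω f → ∃ a : DiffAlg Ω, ∀ j ∈ Ω, a.toFun j = f j :=
    fun f hf => ⟨.mk f hf, fun j hj => DiffAlg.toFun_mk f hf hj⟩
  obtain ⟨a, ha⟩ := hex P'.1 h'.fst
  obtain ⟨b, hb⟩ := hex P'.2 h'.snd
  obtain ⟨u, v, hu, hv, huv⟩ := h''.exists_lie_add_lie_eq_zero
  have haI : a ∈ solIdeal Ω := fun j hj hs => (ha j hj).trans (h'.fst_eq_zero j ⟨hj, hs⟩)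
  have hbI : b ∈ solIdeal Ω := fun j hj hs => (hb j hj).trans (h'.snd_eq_zero j ⟨hj, hs⟩)
  have hFa : F = a + u := DiffAlg.ext_apply fun j hj => by
    rw [← hF j hj, DiffAlg.toFun_add, ha j hj, hu j hj, (hsum j hj).1]
  have hGb : G = b + v := DiffAlg.ext_apply fun j hj => by
    rw [← hG j hj, DiffAlg.toFun_add, hb j hj, hv j hj, (hsum j hj).2]
  obtain ⟨N₀, hN₀⟩ := euler_add_euler_eq_zero_of_null huv
  -- The summands `u`, `v` may have higher order than `F`, `G`, hence the larger truncation before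
  -- splitting.
  rw [← euler_eq_of_le _ (le_max_left N N₀) hFN, ← euler_eq_of_le _ (le_max_left N N₀) hGN, hFa, hGb,
    euler_add, euler_add, add_add_add_comm, hN₀ _ (le_max_right _ _), add_zero]
  exact (solIdeal Ω).add_mem (euler_etaAxis_mem_solIdeal haI _) (euler_xiAxis_mem_solIdeal hbI _)

theorem sum_coordW_mul_mem_solIdeal {c : ℕ → ℕ × ℕ} (hc : ∀ l, ∃ k m, c (l + 1) = (k + 1, m + 1))
    (h : ℕ → DiffAlg Ω) (r : ℕ) :
    ∑ l ∈ Finset.range r, coordW (c (l + 1)) * h l ∈ solIdeal Ω := by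
  refine (solIdeal Ω).sum_mem fun l _ j hj hs => ?_
  obtain ⟨k, m, hkm⟩ := hc l
  rw [DiffAlg.toFun_mul, coordW_toFun _ hj, hkm]
  exact mul_eq_zero_of_left (hs k m) _

/-- The two integrations by parts add up to w_{11} times the sum of the Euler operators, which is
zero. So (F + R, G + Q) is a null divergence, while `R` and `Q` vanish on solutions. -/
theorem isTrivialConservedCurrent_of_euler {P : (Jet → ℝ) × (Jet → ℝ)} {F G : DiffAlg Ω}
    (hF : ∀ j ∈ Ω, P.1 j = F.toFun j) (hG : ∀ j ∈ Ω, P.2 j = G.toFun j) {r : ℕ}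
    (hFr : IsCylinder (etaAxis.trunc r) Ω F.toFun) (hGr : IsCylinder (xiAxis.trunc r) Ω G.toFun)
    (h : etaAxis.euler (r + 1) F + xiAxis.euler (r + 1) G = 0) :
    IsTrivialConservedCurrent Ω P := by
  have e1 := lie_add_lie_field hFr (v := fieldXi) (c := fun l => (1, l))
    (fun j => by rw [fieldXi_val]; rfl) (fun l j => by rw [fieldXi_val]; rfl)
    (fun l j => by change (fieldEta.val j).2.2 _ = _; rw [fieldEta_val])
  have e2 := lie_add_lie_field hGr (v := fieldEta) (c := fun k => (k, 1))
    (fun j => by rw [fieldEta_val]; rfl) (fun l j => by rw [fieldEta_val]; rfl)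
    (fun l j => by change (fieldXi.val j).2.2 _ = _; rw [fieldXi_val])
  have hQ := (solIdeal Ω).neg_mem (sum_coordW_mul_mem_solIdeal (c := fun l => (1, l))
    (fun l => ⟨0, l, rfl⟩) (fun l => higherEuler (etaAxis.D Ω) (etaAxis.P Ω) (r + 1) (l + 1) F) r)
  have hR := (solIdeal Ω).neg_mem (sum_coordW_mul_mem_solIdeal (c := fun k => (k, 1))
    (fun l => ⟨l, 0, rfl⟩) (fun l => higherEuler (xiAxis.D Ω) (xiAxis.P Ω) (r + 1) (l + 1) G) r)
  set Q := -∑ l ∈ Finset.range r, coordW (1, l + 1) *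
    higherEuler (etaAxis.D Ω) (etaAxis.P Ω) (r + 1) (l + 1) F
  set R := -∑ k ∈ Finset.range r, coordW (k + 1, 1) *
    higherEuler (xiAxis.D Ω) (xiAxis.P Ω) (r + 1) (k + 1) G
  have hdiv : lie fieldXi (F + R) + lie fieldEta (G + Q) = 0 := by
    have e3 := congrArg₂ (· + ·) e1 e2
    rw [← mul_add, h, mul_zero] at e3
    rw [← e3, map_add, map_add]
    change lie fieldXi F + lie fieldXi R + (lie fieldEta G + lie fieldEta Q) =
      lie fieldXi F + lie fieldEta Q + (lie fieldEta G + lie fieldXi R)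
    abel
  have hP1 : IsDiffFun Ω P.1 := F.isDiffFun.congr hF
  have hP2 : IsDiffFun Ω P.2 := G.isDiffFun.congr hG
  have hP1F : (.mk P.1 hP1 : DiffAlg Ω) = F := DiffAlg.ext_apply fun j hj => by
    rw [DiffAlg.toFun_mk _ _ hj, hF j hj]
  have hP2G : (.mk P.2 hP2 : DiffAlg Ω) = G := DiffAlg.ext_apply fun j hj => by
    rw [DiffAlg.toFun_mk _ _ hj, hG j hj]
  refine ⟨⟨hP1, hP2, ?_⟩, ((-R).toFun, (-Q).toFun), ((F + R).toFun, (G + Q).toFun),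
    ⟨(-R).isDiffFun, (-Q).isDiffFun, ?_, ?_⟩, ⟨(F + R).isDiffFun, (G + Q).isDiffFun, ?_⟩, ?_⟩
  · rintro j ⟨hj, hs⟩
    rw [totalDiv_mk hP1 hP2 hj, hP1F, hP2G]
    -- Conservation follows from the same identity, since total derivatives preserve vanishing on
    -- solutions.
    have e4 : lie fieldXi F + lie fieldEta G = -(lie fieldXi R + lie fieldEta Q) := by
      rw [eq_neg_iff_add_eq_zero, ← hdiv, map_add, map_add]
      abel
    rw [e4]
    exact (solIdeal Ω).neg_mem
      ((solIdeal Ω).add_mem (lieXi_mem_solIdeal hR) (lieEta_mem_solIdeal hQ)) j hj hs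
  · rintro j ⟨hj, hs⟩
    exact (solIdeal Ω).neg_mem hR j hj hs
  · rintro j ⟨hj, hs⟩
    exact (solIdeal Ω).neg_mem hQ j hj hs
  · intro j hj
    rw [totalDiv_mk (F + R).isDiffFun (G + Q).isDiffFun hj, DiffAlg.mk_toFun, DiffAlg.mk_toFun, hdiv,
      DiffAlg.toFun_zero]
  · intro j hj
    simp [hF j hj, hG j hj]

/-! ### Local forms and the Euler operators -/

theorem euler_toFun_of_isOpen {α : Axis} {Ω' : Opens Jet} (h : Ω' ≤ Ω) {f : DiffAlg Ω} {N : ℕ}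
    (hN : ∀ m, N ≤ m → lieW (α.idx m) f = 0) {g : Jet → ℝ} {r : ℕ}
    (hg : IsCylinder (α.trunc r) Ω' g) {C : ℝ}
    (hfg : ∀ j ∈ Ω', f.toFun j = lineDeriv ℝ g j (α.field.val j) + C * j.2.2 (α.idx 1))
    {j : Jet} (hj : j ∈ Ω') : (α.euler N f).toFun j = C := by
  rw [← restrict_toFun h _ hj, restrict_euler]
  refine euler_toFun_of_eq (fun m hm => ?_) hg (fun j hj => ?_) hj
  · rw [← restrict_lie, hN m hm, restrict_zero]
  · rw [restrict_toFun h _ hj, hfg j hj]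

/-- The constants `C` and `-C` cancel at the point, so `C` may differ from point to point. -/
theorem euler_add_euler_of_hasLocalForm {P : (Jet → ℝ) × (Jet → ℝ)} {F G : DiffAlg Ω}
    (hF : ∀ j ∈ Ω, P.1 j = F.toFun j) (hG : ∀ j ∈ Ω, P.2 j = G.toFun j) {N : ℕ}
    (hFN : ∀ m, N ≤ m → lieW (etaAxis.idx m) F = 0)
    (hGN : ∀ m, N ≤ m → lieW (xiAxis.idx m) G = 0) {C : ℝ} {j : Jet}
    (h : HasLocalForm Ω C P j) : (etaAxis.euler N F + xiAxis.euler N G).toFun j = 0 := by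
  obtain ⟨Ω', ho, hj, hs, F', G', ⟨r, hF'⟩, ⟨s, hG'⟩, hform⟩ := h
  replace hF' : IsCylinder (etaAxis.trunc r) Ω' F' := hF'
  replace hG' : IsCylinder (xiAxis.trunc s) Ω' G' := hG'
  have e1 := euler_toFun_of_isOpen (Ω' := ⟨Ω', ho⟩) hs hFN hF' (C := C)
    (fun i hi => by
      rw [← hF i (hs hi), (hform i hi).1, sDEta_eq_lineDeriv (Ω := ⟨Ω', ho⟩) hF' hi]
      rfl) hj
  have e2 := euler_toFun_of_isOpen (Ω' := ⟨Ω', ho⟩) hs hGN hG' (C := -C)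
    (fun i hi => by
      rw [← hG i (hs hi), (hform i hi).2, sDXi_eq_lineDeriv (Ω := ⟨Ω', ho⟩) hG' hi, neg_mul,
        ← sub_eq_add_neg]
      rfl) hj
  rw [DiffAlg.toFun_add, e1, e2, add_neg_cancel]

theorem hasLocalForm_of_euler {P : (Jet → ℝ) × (Jet → ℝ)} {F G : DiffAlg Ω}
    (hF : ∀ j ∈ Ω, P.1 j = F.toFun j) (hG : ∀ j ∈ Ω, P.2 j = G.toFun j)
    (hFp : F ∈ etaAxis.pure Ω) (hGp : G ∈ xiAxis.pure Ω) {N : ℕ}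
    (hFN : ∀ m, N ≤ m → lieW (etaAxis.idx m) F = 0)
    (hGN : ∀ m, N ≤ m → lieW (xiAxis.idx m) G = 0) {C : ℝ}
    (hFC : ∀ j ∈ Ω, (etaAxis.euler N F).toFun j = C)
    (hGC : ∀ j ∈ Ω, (xiAxis.euler N G).toFun j = -C) {j : Jet} (hj : j ∈ Ω) :
    HasLocalForm Ω C P j := by
  obtain ⟨Ω₁, ho₁, hj₁, hs₁, F', ⟨r, hF'⟩, hF1⟩ := exists_local_primitive hFp hFN hFC hj
  obtain ⟨Ω₂, ho₂, hj₂, hs₂, G', ⟨s, hG'⟩, hG1⟩ := exists_local_primitive hGp hGN hGC hj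
  have hF'' := hF'.mono_set (Set.inter_subset_left (s := Ω₁) (t := Ω₂))
  have hG'' := hG'.mono_set (Set.inter_subset_right (s := Ω₁) (t := Ω₂))
  refine ⟨Ω₁ ∩ Ω₂, ho₁.inter ho₂, ⟨hj₁, hj₂⟩, fun i hi => hs₁ hi.1, F', G', ⟨r, hF''⟩, ⟨s, hG''⟩,
    fun i hi => ⟨?_, ?_⟩⟩
  · rw [hF i (hs₁ hi.1), hF1 i hi.1, sDEta_eq_lineDeriv (Ω := ⟨_, ho₁.inter ho₂⟩) hF'' hi]
    rfl
  · rw [hG i (hs₁ hi.1), hG1 i hi.2, sDXi_eq_lineDeriv (Ω := ⟨_, ho₁.inter ho₂⟩) hG'' hi, neg_mul,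
      ← sub_eq_add_neg]
    rfl

/-! ### Product domains -/

/-- The solution jet with the coordinates of `j` on the axis `η` and of `i` on the axis `ξ`. -/
def mixedJet (j i : Jet) : Jet :=
  (i.1, j.2.1, fun p => if p.1 = 0 then j.2.2 p else if p.2 = 0 then i.2.2 p else 0)

theorem mixedJet_mem_solutionManifold (j i : Jet) : mixedJet j i ∈ solutionManifold := fun k l => by
  simp [w, mixedJet]

theorem etaTrunc_mixedJet (r : ℕ) (j i : Jet) : etaAxis.trunc r (mixedJet j i) = etaAxis.trunc r j :=
  rfl

theorem xiTrunc_mixedJet (r : ℕ) (j i : Jet) : xiAxis.trunc r (mixedJet j i) = xiAxis.trunc r i := by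
  refine Prod.ext rfl (funext fun k => ?_)
  simp [trunc_apply, mixedJet, xiAxis]

theorem toFun_eq_of_mem_pure {α : Axis} {f : DiffAlg Ω} (hf : f ∈ α.pure Ω) {j i : Jet} (hj : j ∈ Ω)
    (hi : i ∈ Ω) (h : ∀ r, α.trunc r j = α.trunc r i) : f.toFun j = f.toFun i := by
  obtain ⟨r, φ, -, hφ⟩ := hf
  rw [hφ j hj, hφ i hi, h r]

/-- If the sum of a function on the axis `η` and of a function on the axis `ξ` vanishes on
solutions, then both functions are constant. -/
theorem exists_const_of_add_mem_solIdeal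
    (hmix : ∀ j ∈ Ω, ∀ i ∈ Ω, mixedJet j i ∈ Ω) {f g : DiffAlg Ω} (hf : f ∈ etaAxis.pure Ω)
    (hg : g ∈ xiAxis.pure Ω) (h : f + g ∈ solIdeal Ω) :
    ∃ C : ℝ, (∀ j ∈ Ω, f.toFun j = C) ∧ ∀ j ∈ Ω, g.toFun j = -C := by
  -- Separation of variables: on the mixed jet, a solution jet, `f` sees only `j` and `g` sees only
  -- `i`.
  have key : ∀ j ∈ Ω, ∀ i ∈ Ω, f.toFun j + g.toFun i = 0 := fun j hj i hi => by
    have hm := hmix j hj i hi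
    have := h _ hm (mixedJet_mem_solutionManifold j i)
    rwa [DiffAlg.toFun_add, toFun_eq_of_mem_pure hf hm hj fun r => etaTrunc_mixedJet r j i,
      toFun_eq_of_mem_pure hg hm hi fun r => xiTrunc_mixedJet r j i] at this
  rcases (Ω : Set Jet).eq_empty_or_nonempty with h0 | ⟨i, hi⟩
  · have : ∀ j, j ∉ Ω := fun j hj => by
      have hj' : j ∈ (Ω : Set Jet) := hj
      simp [h0] at hj'
    exact ⟨0, fun j hj => absurd hj (this j), fun j hj => absurd hj (this j)⟩
  · refine ⟨f.toFun i, fun j hj => ?_, fun j hj => ?_⟩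
    · linarith [key j hj i hi, key i hi i hi]
    · linarith [key i hi j hj]

theorem trivial_iff_hasLocalForm (hmix : ∀ j ∈ Ω, ∀ i ∈ Ω, mixedJet j i ∈ Ω)
    {P : (Jet → ℝ) × (Jet → ℝ)} (hP : P ∈ V Ω) :
    (IsTrivialConservedCurrent Ω P ↔ ∃ C : ℝ, ∀ j ∈ Ω, HasLocalForm Ω C P j) ∧
    (IsTrivialConservedCurrent Ω P ↔ ∀ j ∈ Ω, ∃ C : ℝ, HasLocalForm Ω C P j) := by
  obtain ⟨⟨r₁, h₁⟩, ⟨r₂, h₂⟩⟩ := hP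
  have hr₁ : IsCylinder (etaAxis.trunc (max r₁ r₂)) Ω P.1 :=
    isCylinder_trunc_mono (le_max_left _ _) h₁
  have hr₂ : IsCylinder (xiAxis.trunc (max r₁ r₂)) Ω P.2 :=
    isCylinder_trunc_mono (le_max_right _ _) h₂
  set r := max r₁ r₂
  set F : DiffAlg Ω := .mk P.1 (isDiffFun_of_isCylinder hr₁)
  set G : DiffAlg Ω := .mk P.2 (isDiffFun_of_isCylinder hr₂)
  have hF : ∀ j ∈ Ω, P.1 j = F.toFun j := fun j hj => (DiffAlg.toFun_mk _ _ hj).symm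
  have hG : ∀ j ∈ Ω, P.2 j = G.toFun j := fun j hj => (DiffAlg.toFun_mk _ _ hj).symm
  have hFr : IsCylinder (etaAxis.trunc r) Ω F.toFun := hr₁.congr fun j hj => (hF j hj).symm
  have hGr : IsCylinder (xiAxis.trunc r) Ω G.toFun := hr₂.congr fun j hj => (hG j hj).symm
  have hFN := lieW_eq_zero_of_lt hFr
  have hGN := lieW_eq_zero_of_lt hGr
  have h13 : IsTrivialConservedCurrent Ω P → ∃ C : ℝ, ∀ j ∈ Ω, HasLocalForm Ω C P j := fun h => by
    obtain ⟨C, hFC, hGC⟩ := exists_const_of_add_mem_solIdeal hmix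
      (higherEuler_mem_pure ⟨r, hFr⟩ (r + 1) 0) (higherEuler_mem_pure ⟨r, hGr⟩ (r + 1) 0)
      (euler_add_euler_of_trivial h hF hG hFN hGN)
    exact ⟨C, fun j hj => hasLocalForm_of_euler hF hG ⟨r, hFr⟩ ⟨r, hGr⟩ hFN hGN hFC hGC hj⟩
  have h34 : (∃ C : ℝ, ∀ j ∈ Ω, HasLocalForm Ω C P j) →
      ∀ j ∈ Ω, ∃ C : ℝ, HasLocalForm Ω C P j := fun ⟨C, h⟩ j hj => ⟨C, h j hj⟩
  have h41 : (∀ j ∈ Ω, ∃ C : ℝ, HasLocalForm Ω C P j) → IsTrivialConservedCurrent Ω P := fun h =>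
    isTrivialConservedCurrent_of_euler hF hG hFr hGr (DiffAlg.ext_apply fun j hj => by
      obtain ⟨C, hC⟩ := h j hj
      rw [euler_add_euler_of_hasLocalForm hF hG hFN hGN hC, DiffAlg.toFun_zero])
  exact ⟨⟨h13, h41 ∘ h34⟩, ⟨h34 ∘ h13, h41⟩⟩

theorem isOpen_jetDomain {r₁ r₂ : ℕ} {A : Set (ℝ × (Fin r₁ → ℝ))} {B : Set (ℝ × (Fin r₂ → ℝ))}
    (hA : IsOpen A) (hB : IsOpen B) : IsOpen (jetDomain A B) :=
  (hA.preimage (etaAxis.trunc r₁).continuous).inter (hB.preimage (xiAxis.trunc r₂).continuous)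

/-- This is where the product shape of the domain enters; it makes `C` global even when `A` or `B`
is disconnected. -/
theorem mixedJet_mem_jetDomain {r₁ r₂ : ℕ} {A : Set (ℝ × (Fin r₁ → ℝ))}
    {B : Set (ℝ × (Fin r₂ → ℝ))} {j i : Jet} (hj : j ∈ jetDomain A B) (hi : i ∈ jetDomain A B) :
    mixedJet j i ∈ jetDomain A B := by
  refine ⟨hj.1, ?_⟩
  change xiAxis.trunc r₂ (mixedJet j i) ∈ B
  rw [xiTrunc_mixedJet]
  exact hi.2

end

end WaveCC

theorem mainTheorem4 (r₁ r₂ : ℕ) (A : Set (ℝ × (Fin r₁ → ℝ))) (B : Set (ℝ × (Fin r₂ → ℝ)))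
    (hA : IsOpen A) (hB : IsOpen B) :
    WaveCC.V₀ (WaveCC.jetDomain A B) =
        {P ∈ WaveCC.V (WaveCC.jetDomain A B) |
          ∃ C : ℝ, ∀ j ∈ WaveCC.jetDomain A B,
            WaveCC.HasLocalForm (WaveCC.jetDomain A B) C P j} ∧
      WaveCC.V₀ (WaveCC.jetDomain A B) =
        {P ∈ WaveCC.V (WaveCC.jetDomain A B) |
          ∀ j ∈ WaveCC.jetDomain A B, ∃ C : ℝ,
            WaveCC.HasLocalForm (WaveCC.jetDomain A B) C P j} := by
  have key := fun P => WaveCC.trivial_iff_hasLocalForm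
    (Ω := ⟨WaveCC.jetDomain A B, WaveCC.isOpen_jetDomain hA hB⟩) (P := P)
    (fun _ hj _ hi => WaveCC.mixedJet_mem_jetDomain hj hi)
  exact ⟨Set.ext fun P => and_congr_right fun hP => (key P hP).1,
    Set.ext fun P => and_congr_right fun hP => (key P hP).2⟩
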